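/- Setting. Let $k>0$, let $\mathbf y_1,\dots,\mathbf y_N\in\mathbb R^2$ be field points with weights $w_j=\varphi(\mathbf y_j)s(\mathbf y_j)$ ($\varphi$ complex-valued, $s$ real-valued), all lying in a square, the cell of level $0$. Let a finite (possibly non-uniform) quadtree be given: starting from the square of level $0$, some cells of level $L$ are divided into their four children of level $L+1$; an undivided cell is a leaf. Cells are half-open, so the cells of one level are disjoint; two cells are adjacent if their closures meet (a cell is adjacent to itself). $\mathbf O_{\mathcal C}$ is the centroid of $\mathcal C$, $\theta_{\mathbf v}$ the polar angle of $\mathbf v$, and $p\ge 0$ the truncation number. For $\mathscr B\in\{J,H^{(1)}\}$, $m\in\mathbb Z$ and a choice of signs, $$R^{\mathscr B}_{m,p}(\mathbf u,\mathbf v)=\Big(\sum_{n=p+1}^{\infty}+\sum_{n=-\infty}^{-p-1}\Big)\mathscr B_{m+n}(|\mathbf u|)e^{\pm i(m+n)\theta_{\mathbf u}}J_n(|\mathbf v|)e^{\mp in\theta_{\mathbf v}};$$ write $R^H$ and $R^J$ for the upper signs and $R^{J,-}$ for $R^J$ with the lower signs. The well separated cells of a cell $\mathcal D$ of level $L\ge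 2$ are the cells of the tree that contain a field point, are not adjacent to $\mathcal D$, and are either cells of level $L$ whose parent is adjacent to the parent of $\mathcal D$, or leaves of level $<L$ that are adjacent to the parent of $\mathcal D$. The multipole moments are $\mathbf M_n(\mathbf O_{\mathcal C})=\sum_{\mathbf y_j\in\mathcal C}J_n(k|\mathbf y_j-\mathbf O_{\mathcal C}|)e^{-in\theta_{\mathbf y_j-\mathbf O_{\mathcal C}}}w_j$. The approximate moments $\widetilde{\mathbf M}_n$ and the errors $EM_n$ are given, for a leaf, by $\widetilde{\mathbf M}_n=\mathbf M_n$, $EM_n=0$ and, for a divided cell $\mathcal C$ with children $\mathcal C_i$ that contain a field point, by $$\widetilde{\mathbf M}_n(\mathbf O_{\mathcal C},p)=\sum_i\sum_{l=-p}^p\widetilde{\mathbf M}_l(\mathbf O_{\mathcal C_i},p)J_{n-l}(k|\mathbf O_{\mathcal C_i}-\mathbf O_{\mathcal C}|)e^{-i(n-l)\theta_{\mathbf O_{\mathcal C_i}-\mathbf O_{\mathcal C}}},$$ $$EM_n(\mathbf O_{\mathcal C},p)=\sum_i\Big(\sum_{l=-p}^pEM_l(\mathbf O_{\mathcal C_i},p)J_{n-l}(k|\mathbf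 O_{\mathcal C_i}-\mathbf O_{\mathcal C}|)e^{-i(n-l)\theta_{\mathbf O_{\mathcal C_i}-\mathbf O_{\mathcal C}}}+\sum_{\mathbf y_j\in\mathcal C_i}R^{J,-}_{n,p}\big(k(\mathbf O_{\mathcal C_i}-\mathbf O_{\mathcal C}),-k(\mathbf y_j-\mathbf O_{\mathcal C_i})\big)w_j\Big).$$ Theorem 3. Let $L_{max}\ge2$, let $\mathcal D_L$ ($2\le L\le L_{max}$) be cells of the tree, $\mathcal D_L$ of level $L$, $\mathcal D_{L-1}$ the parent of $\mathcal D_L$ for $L\ge3$, and $\mathcal D_{L_{max}}$ a leaf. Let $\mathcal{DI}_i$ ($1\le i\le n_{\mathcal D_L}$) denote the well separated cells of $\mathcal D_L$, and let $\mathcal{DA}$ be the union of the cells adjacent to $\mathcal D_{L_{max}}$ that have level $L_{max}$ or are leaves of level $<L_{max}$. The approximate local moments are $$\widetilde{\mathbf L}_m(\mathbf O_{\mathcal D_L},p)=\sum_{i=1}^{n_{\mathcal D_L}}\sum_{n=-p}^p\widetilde{\mathbf M}_n(\mathbf O_{\mathcal{DI}_i},p)H^{(1)}_{n-m}(k|\mathbf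 O_{\mathcal D_L}-\mathbf O_{\mathcal{DI}_i}|)e^{i(n-m)\theta_{\mathbf O_{\mathcal D_L}-\mathbf O_{\mathcal{DI}_i}}}+\sum_{l=-p}^p\widetilde{\mathbf L}_l(\mathbf O_{\mathcal D_{L-1}},p)J_{l-m}(k|\mathbf O_{\mathcal D_L}-\mathbf O_{\mathcal D_{L-1}}|)e^{i(l-m)\theta_{\mathbf O_{\mathcal D_L}-\mathbf O_{\mathcal D_{L-1}}}},$$ the last sum being absent for $L=2$. Let $\mathbf x\in\mathcal D_{L_{max}}$ and suppose that, whenever a well separated cell $\mathcal{DI}_i$ of $\mathcal D_L$ is more than two levels coarser than $\mathcal D_L$, $|\mathbf y_j-\mathbf O_{\mathcal{DI}_i}|<|\mathbf x-\mathbf O_{\mathcal{DI}_i}|$ for all $\mathbf y_j\in\mathcal{DI}_i$. Then $$\sum_{\mathbf y_j\notin\mathcal{DA}}H^{(1)}_0(k|\mathbf x-\mathbf y_j|)w_j=\sum_{m=-p}^p\widetilde{\mathbf L}_m(\mathbf O_{\mathcal D_{L_{max}}},p)J_m(k|\mathbf x-\mathbf O_{\mathcal D_{L_{max}}}|)e^{im\theta_{\mathbf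 x-\mathbf O_{\mathcal D_{L_{max}}}}}+E_S(\mathbf x,p),$$ $$\begin{aligned}E_S(\mathbf x,p)=&\sum_{L=2}^{L_{max}}\sum_{i=1}^{n_{\mathcal D_L}}\sum_{\mathbf y_j\in\mathcal{DI}_i}R^H_{0,p}\big(k(\mathbf x-\mathbf O_{\mathcal{DI}_i}),k(\mathbf y_j-\mathbf O_{\mathcal{DI}_i})\big)w_j\\&+\sum_{L=2}^{L_{max}}\sum_{i=1}^{n_{\mathcal D_L}}\sum_{n=-p}^pH^{(1)}_n(k|\mathbf x-\mathbf O_{\mathcal{DI}_i}|)e^{in\theta_{\mathbf x-\mathbf O_{\mathcal{DI}_i}}}EM_n(\mathbf O_{\mathcal{DI}_i},p)\\&+\sum_{L=2}^{L_{max}}\sum_{i=1}^{n_{\mathcal D_L}}\sum_{n=-p}^pR^H_{n,p}\big(k(\mathbf O_{\mathcal D_L}-\mathbf O_{\mathcal{DI}_i}),-k(\mathbf x-\mathbf O_{\mathcal D_L})\big)\widetilde{\mathbf M}_n(\mathbf O_{\mathcal{DI}_i},p)\\&+\sum_{L=3}^{L_{max}}\sum_{n=-p}^pR^J_{n,p}\big(k(\mathbf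 O_{\mathcal D_L}-\mathbf O_{\mathcal D_{L-1}}),-k(\mathbf x-\mathbf O_{\mathcal D_L})\big)\widetilde{\mathbf L}_n(\mathbf O_{\mathcal D_{L-1}},p).\end{aligned}$$ Moreover $\mathbf M_n(\mathbf O_{\mathcal C})=\widetilde{\mathbf M}_n(\mathbf O_{\mathcal C},p)+EM_n(\mathbf O_{\mathcal C},p)$ for every cell $\mathcal C$ of the tree and every $n\in\mathbb Z$, and the series of all the remainders $R$ above converge absolutely. -/

import Mathlib

noncomputable section

/-! ### Cylinder functions of integer order -/

/-- Extends a sequence of functions of order `0, 1, 2, …` to integer orders by the rule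
`B_{-n} = (-1)^n B_n`. -/
def intOrder (B : ℕ → ℝ → ℝ) : ℤ → ℝ → ℝ
  | Int.ofNat n, r => B n r
  | Int.negSucc n, r => (-1) ^ (n + 1) * B (n + 1) r

/-- The Bessel function of the first kind `J_n`, `n = 0, 1, 2, …`. -/
def besselJNat (n : ℕ) (r : ℝ) : ℝ :=
  (r / 2) ^ n * ∑' i : ℕ, (-(r ^ 2 / 4)) ^ i / ((i.factorial : ℝ) * ((n + i).factorial : ℝ))

/-- The digamma function at a positive integer, `ψ(n + 1) = 1 + 1/2 + ⋯ + 1/n - γ`. -/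
def psiSucc (n : ℕ) : ℝ := (harmonic n : ℝ) - Real.eulerMascheroniConstant

/-- The Bessel function of the second kind (Neumann function) `Y_n`, `n = 0, 1, 2, …`, at `r > 0`. -/
def besselYNat (n : ℕ) (r : ℝ) : ℝ :=
  -((r / 2) ^ n)⁻¹ / Real.pi *
      ∑ i ∈ Finset.range n, ((n - 1 - i).factorial : ℝ) / (i.factorial : ℝ) * (r ^ 2 / 4) ^ i
    + 2 / Real.pi * Real.log (r / 2) * besselJNat n r
    - (r / 2) ^ n / Real.pi *
      ∑' i : ℕ, (psiSucc i + psiSucc (n + i)) * (-(r ^ 2 / 4)) ^ i /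
        ((i.factorial : ℝ) * ((n + i).factorial : ℝ))

/-- `J_n(r)` for `n ∈ ℤ`, as a complex number. -/
def besselJ (n : ℤ) (r : ℝ) : ℂ := (intOrder besselJNat n r : ℂ)

/-- `Y_n(r)` for `n ∈ ℤ`, as a complex number. -/
def besselY (n : ℤ) (r : ℝ) : ℂ := (intOrder besselYNat n r : ℂ)

/-- The Hankel function of the first kind `H_n^{(1)} = J_n + i Y_n`, for `n ∈ ℤ`. -/
def hankelH (n : ℤ) (r : ℝ) : ℂ := besselJ n r + Complex.I * besselY n r

/-- `e^{i m θ_z}`, where `θ_z` is the polar angle of `z`; points of the plane are complex numbers. -/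
def angExp (m : ℤ) (z : ℂ) : ℂ := Complex.exp (Complex.I * (m : ℂ) * (Complex.arg z : ℂ))

/-- The `n`-th term `B_{m+n}(|u|) e^{± i (m+n) θ_u} J_n(|v|) e^{∓ i n θ_v}` of the series in Graf's
addition theorem; the upper signs are `σ = 1`, the lower signs are `σ = -1`. -/
def grafTerm (B : ℤ → ℝ → ℂ) (σ : ℤ) (m : ℤ) (u v : ℂ) (n : ℤ) : ℂ :=
  B (m + n) ‖u‖ * angExp (σ * (m + n)) u * (besselJ n ‖v‖ * angExp (-(σ * n)) v)

/-- The remainder `R^B_{m,p}(u, v)` (the terms with `n ≥ p + 1` and `n ≤ -p - 1`). -/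
def grafRemainder (B : ℤ → ℝ → ℂ) (σ : ℤ) (m : ℤ) (p : ℕ) (u v : ℂ) : ℂ :=
  (∑' i : ℕ, grafTerm B σ m u v ((p : ℤ) + 1 + i))
    + ∑' i : ℕ, grafTerm B σ m u v (-(p : ℤ) - 1 - i)

/-! ### Quadtrees -/

/-- A dyadic cell: `level` is its level, `(i, j)` its column and row among the cells of that
level. -/
@[ext]
structure Cell where
  level : ℕ
  i : ℤ
  j : ℤ

/-- The cell of level `0`. -/
def Cell.root : Cell := ⟨0, 0, 0⟩

/-- The four children of a cell. -/
def Cell.child (C : Cell) (c : Fin 2 × Fin 2) : Cell :=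
  ⟨C.level + 1, 2 * C.i + ((c.1 : ℕ) : ℤ), 2 * C.j + ((c.2 : ℕ) : ℤ)⟩

/-- The parent of a cell of positive level. -/
def Cell.parent (C : Cell) : Cell := ⟨C.level - 1, C.i / 2, C.j / 2⟩

/-- A (finite, possibly non-uniform) quadtree: starting from the cell of level `0`, some cells are
divided into their four children. -/
structure QuadTree where
  cells : Finset Cell
  root_mem : Cell.root ∈ cells
  eq_root : ∀ C ∈ cells, C.level = 0 → C = Cell.root
  parent_mem : ∀ C ∈ cells, C.level ≠ 0 → C.parent ∈ cells
  child_mem : ∀ C ∈ cells, ∀ c c' : Fin 2 × Fin 2, C.child c ∈ cells → C.child c' ∈ cells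

/-- A leaf cell: a cell of the tree without children. -/
def QuadTree.IsLeaf (T : QuadTree) (C : Cell) : Prop :=
  C ∈ T.cells ∧ ∀ c, C.child c ∉ T.cells

/-- The largest level of a cell of the tree. -/
def QuadTree.depth (T : QuadTree) : ℕ := T.cells.sup Cell.level

/-! ### The fast multipole method -/

/-- The data of the method: the wave number `k`, the square of level `0` (lower left corner and
side length), the quadtree, the field points `y_j`, the density `φ` and the factor `s`. -/
structure FMM (N : ℕ) where
  k : ℝ
  corner : ℂ
  side : ℝ
  tree : QuadTree
  y : Fin N → ℂ
  φ : ℂ → ℂ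
  s : ℂ → ℝ

namespace FMM

variable {N : ℕ}

/-- The side length of the cells of a level. -/
def width (F : FMM N) (L : ℕ) : ℝ := F.side / 2 ^ L

/-- The centroid `O_C` of a cell. -/
def center (F : FMM N) (C : Cell) : ℂ :=
  F.corner + (⟨((C.i : ℝ) + 1 / 2) * F.width C.level, ((C.j : ℝ) + 1 / 2) * F.width C.level⟩ : ℂ)

/-- The points of a cell. Cells are half-open squares, so that the cells of one level are
disjoint. -/
def region (F : FMM N) (C : Cell) : Set ℂ :=
  {z | (C.i : ℝ) * F.width C.level ≤ (z - F.corner).re ∧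
       (z - F.corner).re < ((C.i : ℝ) + 1) * F.width C.level ∧
       (C.j : ℝ) * F.width C.level ≤ (z - F.corner).im ∧
       (z - F.corner).im < ((C.j : ℝ) + 1) * F.width C.level}

/-- The corresponding closed square. -/
def closedRegion (F : FMM N) (C : Cell) : Set ℂ :=
  {z | (C.i : ℝ) * F.width C.level ≤ (z - F.corner).re ∧
       (z - F.corner).re ≤ ((C.i : ℝ) + 1) * F.width C.level ∧
       (C.j : ℝ) * F.width C.level ≤ (z - F.corner).im ∧
       (z - F.corner).im ≤ ((C.j : ℝ) + 1) * F.width C.level}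

/-- Two cells (of equal or different levels) are adjacent if their closed squares meet. A cell is
adjacent to itself. -/
def Adjacent (F : FMM N) (C D : Cell) : Prop := (F.closedRegion C ∩ F.closedRegion D).Nonempty

open Classical in
/-- The (indices of the) field points in a cell. -/
def pointsIn (F : FMM N) (C : Cell) : Finset (Fin N) := {j | F.y j ∈ F.region C}

/-- The weight `φ(y_j) s(y_j)` of a field point. -/
def weight (F : FMM N) (j : Fin N) : ℂ := F.φ (F.y j) * (F.s (F.y j) : ℂ)

open Classical in
/-- The nonempty well separated cells of a cell `D` of level `L`: cells of level `L` that are not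
adjacent to `D` but whose parents are adjacent to the parent of `D`, and leaf cells of a smaller
level that are not adjacent to `D` but are adjacent to the parent of `D`. -/
def wellSeparated (F : FMM N) (D : Cell) : Finset Cell :=
  {C ∈ F.tree.cells | (F.pointsIn C).Nonempty ∧ ¬ F.Adjacent C D ∧
    ((C.level = D.level ∧ F.Adjacent C.parent D.parent) ∨
      (C.level < D.level ∧ F.tree.IsLeaf C ∧ F.Adjacent C D.parent))}

open Classical in
/-- The adjacent cells of a leaf cell `D` of level `L` (`D` itself included), among the cells of
level `L` and the leaf cells of smaller level. -/
def adjacentCells (F : FMM N) (D : Cell) : Finset Cell :=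
  {C ∈ F.tree.cells | F.Adjacent C D ∧
    (C.level = D.level ∨ (C.level < D.level ∧ F.tree.IsLeaf C))}

open Classical in
/-- The far field of a leaf cell: the field points that lie in none of its adjacent cells. -/
def farPoints (F : FMM N) (D : Cell) : Finset (Fin N) :=
  {j | ∀ C ∈ F.adjacentCells D, F.y j ∉ F.region C}

open Classical in
/-- The nonempty children of a cell. -/
def nonemptyChildren (F : FMM N) (C : Cell) : Finset (Fin 2 × Fin 2) :=
  {c | (F.pointsIn (C.child c)).Nonempty}

/-- The exact multipole moments `M_n(O_C)`. -/
def moment (F : FMM N) (C : Cell) (n : ℤ) : ℂ :=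
  ∑ j ∈ F.pointsIn C,
    besselJ n (F.k * ‖F.y j - F.center C‖) * angExp (-n) (F.y j - F.center C) * F.weight j

/-- The truncation error `E_{M2M}(O_C, n, p)` of the translation of moments from the children. -/
def errM2M (F : FMM N) (p : ℕ) (C : Cell) (n : ℤ) : ℂ :=
  ∑ c ∈ F.nonemptyChildren C, ∑ j ∈ F.pointsIn (C.child c),
    grafRemainder besselJ (-1) n p ((F.k : ℂ) * (F.center (C.child c) - F.center C))
      (-((F.k : ℂ) * (F.y j - F.center (C.child c)))) * F.weight j

theorem depth_lt {T : QuadTree} {C : Cell} (h : C ∈ T.cells ∧ ¬ T.IsLeaf C)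
    (c : Fin 2 × Fin 2) :
    T.depth + 1 - (C.child c).level < T.depth + 1 - C.level := by
  have h1 : C.level ≤ T.depth := Finset.le_sup (f := Cell.level) h.1
  have h2 : (C.child c).level = C.level + 1 := rfl
  omega

open Classical in
/-- The approximate multipole moments `M̃_n(O_C, p)` of a cell of the tree: exact for a leaf,
obtained from the children by the truncated translation otherwise. -/
def approxMoment (F : FMM N) (p : ℕ) (C : Cell) (n : ℤ) : ℂ :=
  if h : C ∈ F.tree.cells ∧ ¬ F.tree.IsLeaf C then
    ∑ c ∈ F.nonemptyChildren C, ∑ l ∈ Finset.Icc (-(p : ℤ)) p,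
      approxMoment F p (C.child c) l *
        (besselJ (n - l) (F.k * ‖F.center (C.child c) - F.center C‖) *
          angExp (-(n - l)) (F.center (C.child c) - F.center C))
  else F.moment C n
termination_by F.tree.depth + 1 - C.level
decreasing_by exact depth_lt h c

open Classical in
/-- The propagated errors `EM_n(O_C, p)` of the multipole moments of a cell of the tree: zero for a
leaf, obtained from the errors of the children and the new truncation error otherwise. -/
def momentError (F : FMM N) (p : ℕ) (C : Cell) (n : ℤ) : ℂ :=
  if h : C ∈ F.tree.cells ∧ ¬ F.tree.IsLeaf C then
    (∑ c ∈ F.nonemptyChildren C, ∑ l ∈ Finset.Icc (-(p : ℤ)) p,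
      momentError F p (C.child c) l *
        (besselJ (n - l) (F.k * ‖F.center (C.child c) - F.center C‖) *
          angExp (-(n - l)) (F.center (C.child c) - F.center C)))
      + F.errM2M p C n
  else 0
termination_by F.tree.depth + 1 - C.level
decreasing_by exact depth_lt h c

/-- The moments produced by the multipole-to-local translation from the well separated cells. -/
def localM2L (F : FMM N) (p : ℕ) (D : Cell) (m : ℤ) : ℂ :=
  ∑ C ∈ F.wellSeparated D, ∑ n ∈ Finset.Icc (-(p : ℤ)) p,
    F.approxMoment p C n *
      (hankelH (n - m) (F.k * ‖F.center D - F.center C‖) *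
        angExp (n - m) (F.center D - F.center C))

/-- The approximate local moments of a cell `D` of level `t + 2`: the contribution of the well
separated cells plus, for `t > 0`, the truncated translation of the local moments of the parent. -/
def approxLocalAux (F : FMM N) (p : ℕ) : ℕ → Cell → ℤ → ℂ
  | 0, D, m => F.localM2L p D m
  | t + 1, D, m => F.localM2L p D m +
      ∑ l ∈ Finset.Icc (-(p : ℤ)) p, approxLocalAux F p t D.parent l *
        (besselJ (l - m) (F.k * ‖F.center D - F.center D.parent‖) *
          angExp (l - m) (F.center D - F.center D.parent))

/-- The approximate local moments `L̃_m(O_D, p)` of a cell of level at least `2`. -/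
def approxLocal (F : FMM N) (p : ℕ) (D : Cell) (m : ℤ) : ℂ :=
  F.approxLocalAux p (D.level - 2) D m

end FMM

end

/-! The analytic core is Graf's addition theorem for `J` and `H^{(1)}` of integer order, proved here
from the defining series. With the angular factor included, a cylinder function is `f_m(z) = (z/2)^m
A_m(|z|²/4)`, and the relations `A_n' = -A_{n+1}` and `A_n = (n+1) A_{n+1} - q A_{n+2}` say that
differentiation along a line only shifts the order (`hasDerivAt_ladder`). Hence, for `c_n(t)` the
conjugate of the `J`-wave at `v - tv` and `G_m(t) = f_m(u - tv)`, the `t`-derivative of `∑ c_n(t)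
G_{m+n}(t)` telescopes. A summable bound, uniform in `t`, kills the boundary terms, so the sum is
the same at both ends: at `t = 0` it is Graf's series, at `t = 1` only `n = 0` survives and gives
`f_m(u - v)` (`hasSum_of_ladder_relation`). For `J` the bound always exists; for `H^{(1)}` it comes
from `|v| < |u|`, through a geometric ratio valid along the whole segment.

Every step of the fast multipole method is one truncated Graf series, and the remainder is by
definition the discarded tail. The moment errors then follow by induction up the tree
(`moment_eq_approxMoment_add_momentError`), and one well separated cell contributes its multipole
expansion re-expanded about the centre of `D` (`sum_pointsIn_eq`).

Combinatorially, at each level the field points are partitioned among the cells of that level and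
the coarser leaves. Hence the far field of `D` is the disjoint union of the far field of its parent
and the points of the well separated cells of `D` (`sum_farPoints`). At level 1 the far field is
empty, since all cells meet at the midpoint of the root. Induction on the level accumulates the
errors (`sum_farPoints_eq`).

Geometrically, cells that are not adjacent are separated, in some coordinate, by at least one width
of the finer cell. This gives the inequality needed for the multipole-to-local step at every level
difference, but the one needed for the multipole expansion only up to difference two; beyond that it
is assumed. -/

noncomputable section

open scoped ComplexConjugate

/-! ### Power series with coefficients bounded by those of the exponential series -/

/-- The sum of the power series with coefficients `a`. -/
def powerSum (a : ℕ → ℝ) (q : ℝ) : ℝ := ∑' i, a i * q ^ i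

theorem abs_coeff_mul_pow_le {a : ℕ → ℝ} {K : ℝ} (h : ∀ i, |a i| ≤ K / i.factorial) (q : ℝ)
    (i : ℕ) : |a i * q ^ i| ≤ K * (|q| ^ i / i.factorial) := by
  rw [abs_mul, abs_pow]
  calc |a i| * |q| ^ i ≤ K / i.factorial * |q| ^ i := by gcongr; exact h i
    _ = _ := by ring

theorem summable_powerSum {a : ℕ → ℝ} {K : ℝ} (h : ∀ i, |a i| ≤ K / i.factorial) (q : ℝ) :
    Summable fun i => a i * q ^ i :=
  Summable.of_norm_bounded ((Real.summable_pow_div_factorial |q|).mul_left K)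
    (abs_coeff_mul_pow_le h q)

theorem abs_powerSum_le {a : ℕ → ℝ} {K : ℝ} (h : ∀ i, |a i| ≤ K / i.factorial) (q : ℝ) :
    |powerSum a q| ≤ K * Real.exp |q| := by
  have h1 : HasSum (fun i : ℕ => K * (|q| ^ i / i.factorial)) (K * Real.exp |q|) := by
    rw [Real.exp_eq_exp_ℝ]
    exact (NormedSpace.expSeries_div_hasSum_exp |q|).mul_left K
  rw [← Real.norm_eq_abs]
  exact tsum_of_norm_bounded h1 (abs_coeff_mul_pow_le h q)

theorem powerSum_eq_zero_add {a : ℕ → ℝ} {K : ℝ} (h : ∀ i, |a i| ≤ K / i.factorial) (q : ℝ) :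
    powerSum a q = a 0 + q * powerSum (fun i => a (i + 1)) q := by
  rw [powerSum, (summable_powerSum h q).tsum_eq_zero_add, powerSum, ← tsum_mul_left]
  congr 1
  · simp
  · congr 1; ext i; ring

/-- Termwise differentiation on the ball of radius `|q| + 1`: there the derivatives are dominated by
a shifted exponential series. -/
theorem hasDerivAt_powerSum {a : ℕ → ℝ} {K : ℝ} (h : ∀ i, |a i| ≤ K / i.factorial) (q : ℝ) :
    HasDerivAt (powerSum a) (powerSum (fun i => (i + 1) * a (i + 1)) q) q := by
  have hK : 0 ≤ K := by simpa using (abs_nonneg _).trans (h 0)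
  set R : ℝ := |q| + 1
  have hu : Summable fun i : ℕ => K / i.factorial * (i * R ^ (i - 1)) := by
    rw [← summable_nat_add_iff 1]
    refine ((Real.summable_pow_div_factorial R).mul_left K).congr fun i => ?_
    have : ((i.factorial : ℕ) : ℝ) ≠ 0 := by positivity
    simp only [Nat.factorial_succ, add_tsub_cancel_right]
    push_cast
    field_simp
  have hq : q ∈ Metric.ball (0 : ℝ) R := by simp [R]
  have h1 : HasDerivAt (fun y => ∑' i, a i * y ^ i) (∑' i : ℕ, a i * (i * q ^ (i - 1))) q := by
    refine hasDerivAt_tsum_of_isPreconnected (t := Metric.ball 0 R) (y₀ := 0)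
      (g := fun i y => a i * y ^ i) (g' := fun i y => a i * (i * y ^ (i - 1))) hu
      Metric.isOpen_ball (convex_ball _ _).isPreconnected ?_ ?_ ?_ ?_ hq
    · intro i y _
      exact (hasDerivAt_pow i y).const_mul _
    · intro i y hy
      have hy' : |y| ≤ R := by simpa using (Metric.mem_ball.mp hy).le
      rw [Real.norm_eq_abs, abs_mul, abs_mul, abs_pow, Nat.abs_cast]
      gcongr
      exact h i
    · simp [R]; positivity
    · exact summable_powerSum h 0
  refine h1.congr_deriv ?_
  have h2 : Summable fun i : ℕ => a i * (i * q ^ (i - 1)) := by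
    refine Summable.of_norm_bounded hu fun i => ?_
    rw [Real.norm_eq_abs, abs_mul, abs_mul, abs_pow, Nat.abs_cast]
    gcongr
    · exact h i
    · simp [R]
  rw [h2.tsum_eq_zero_add, powerSum]
  simp only [CharP.cast_eq_zero, zero_mul, mul_zero, zero_add, add_tsub_cancel_right]
  congr 1; ext i; push_cast; ring

theorem powerSum_sub {a b : ℕ → ℝ} {K K' : ℝ} (ha : ∀ i, |a i| ≤ K / i.factorial)
    (hb : ∀ i, |b i| ≤ K' / i.factorial) (q : ℝ) :
    powerSum (fun i => a i - b i) q = powerSum a q - powerSum b q := by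
  rw [powerSum, powerSum, powerSum,
    ← (summable_powerSum ha q).tsum_sub (summable_powerSum hb q)]
  congr 1; ext i; ring

theorem powerSum_neg (a : ℕ → ℝ) (q : ℝ) :
    powerSum (fun i => -a i) q = -powerSum a q := by
  rw [powerSum, powerSum, ← tsum_neg]
  congr 1; ext i; ring

theorem powerSum_const_mul (a : ℕ → ℝ) (c q : ℝ) :
    powerSum (fun i => c * a i) q = c * powerSum a q := by
  rw [powerSum, powerSum, ← tsum_mul_left]
  congr 1; ext i; ring

/-! ### The Bessel functions as functions of `q = r ^ 2 / 4` -/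

/-- The coefficients of `radialJ`. -/
def coeffJ (n i : ℕ) : ℝ := (-1) ^ i / (i.factorial * (n + i).factorial)

/-- The coefficients of `radialPsi`. -/
def coeffPsi (n i : ℕ) : ℝ :=
  (psiSucc i + psiSucc (n + i)) * (-1) ^ i / (i.factorial * (n + i).factorial)

theorem psiSucc_succ (n : ℕ) : psiSucc (n + 1) = psiSucc n + 1 / (n + 1) := by
  simp only [psiSucc, harmonic_succ]
  push_cast
  ring

theorem abs_psiSucc_le (n : ℕ) : |psiSucc n| ≤ n + 1 := by
  induction n with
  | zero =>
    have h1 := Real.one_half_lt_eulerMascheroniConstant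
    have h2 := Real.eulerMascheroniConstant_lt_two_thirds
    simp only [psiSucc, harmonic_zero, abs_le]
    push_cast
    constructor <;> linarith
  | succ n ih =>
    rw [psiSucc_succ]
    refine (abs_add_le _ _).trans ?_
    have h1 : |(1 : ℝ) / (n + 1)| ≤ 1 := by
      rw [abs_of_nonneg (by positivity), div_le_one (by positivity)]
      linarith [(Nat.cast_nonneg n : (0 : ℝ) ≤ n)]
    push_cast
    linarith

theorem abs_coeffJ_le (n i : ℕ) : |coeffJ n i| ≤ (1 / n.factorial) / i.factorial := by
  rw [coeffJ, abs_div, abs_pow, abs_neg, abs_one, one_pow, abs_of_nonneg (by positivity),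
    div_div, mul_comm]
  have : n.factorial ≤ (n + i).factorial := Nat.factorial_le (by omega)
  gcongr

theorem abs_coeffPsi_le (n i : ℕ) : |coeffPsi n i| ≤ 4 / i.factorial := by
  rw [coeffPsi, abs_div, abs_mul, abs_pow, abs_neg, abs_one, one_pow, mul_one,
    abs_of_nonneg (a := (i.factorial : ℝ) * _) (by positivity), mul_comm, ← div_div]
  gcongr
  rw [div_le_iff₀ (by positivity)]
  refine (abs_add_le _ _).trans ((add_le_add (abs_psiSucc_le _) (abs_psiSucc_le _)).trans ?_)
  -- The two digamma values add up to at most `2 (n + i + 1)`, and this crude bound turns that into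
  -- `4 (n + i)!`, whence the constant 4.
  have h1 : ∀ m : ℕ, m + 1 ≤ 2 * m.factorial := by
    intro m
    have := Nat.self_le_factorial m
    have := Nat.factorial_pos m
    omega
  have h2 : ((n + i : ℕ) : ℝ) + 1 ≤ 2 * (n + i).factorial := by exact_mod_cast h1 (n + i)
  push_cast at h2 ⊢
  linarith [(Nat.cast_nonneg n : (0 : ℝ) ≤ n)]

/-- `J_n(r) = (r / 2) ^ n * radialJ n (r ^ 2 / 4)`. -/
def radialJ (n : ℕ) (q : ℝ) : ℝ := powerSum (coeffJ n) q

theorem hasDerivAt_radialJ (n : ℕ) (q : ℝ) :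
    HasDerivAt (radialJ n) (-radialJ (n + 1) q) q := by
  refine (hasDerivAt_powerSum (abs_coeffJ_le n) q).congr_deriv ?_
  rw [radialJ, ← powerSum_neg]
  congr 1; ext i
  rw [coeffJ, coeffJ, show n + (i + 1) = n + 1 + i by ring, Nat.factorial_succ i]
  push_cast
  field_simp
  ring

theorem radialJ_recurrence (n : ℕ) (q : ℝ) :
    radialJ n q = (n + 1) * radialJ (n + 1) q - q * radialJ (n + 2) q := by
  have h : powerSum (fun i => coeffJ n (i + 1)) q
      = (n + 1) * powerSum (fun i => coeffJ (n + 1) (i + 1)) q - powerSum (coeffJ (n + 2)) q := by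
    have h1 : ∀ i, |(n + 1 : ℝ) * coeffJ (n + 1) (i + 1)| ≤ (n + 1) / i.factorial := by
      intro i
      rw [abs_mul, abs_of_nonneg (by positivity : (0 : ℝ) ≤ n + 1), div_eq_mul_one_div]
      gcongr
      refine (abs_coeffJ_le _ _).trans ?_
      have h3 : (1 : ℝ) ≤ (n + 1).factorial := by exact_mod_cast Nat.factorial_pos _
      have h4 : i.factorial ≤ (i + 1).factorial := Nat.factorial_le (by omega)
      rw [div_div]
      apply one_div_le_one_div_of_le (by positivity)
      have h5 : (i.factorial : ℝ) ≤ (i + 1).factorial := by exact_mod_cast h4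
      nlinarith [(by positivity : (0 : ℝ) < (i + 1).factorial)]
    rw [← powerSum_const_mul, ← powerSum_sub h1 (abs_coeffJ_le (n + 2))]
    congr 1; ext i
    simp only [coeffJ]
    rw [show n + 1 + (i + 1) = n + i + 2 by ring, show n + 2 + i = n + i + 2 by ring,
      show n + (i + 1) = n + i + 1 by ring, Nat.factorial_succ i, Nat.factorial_succ (n + i + 1)]
    push_cast
    field_simp
    ring
  rw [radialJ, radialJ, radialJ, powerSum_eq_zero_add (abs_coeffJ_le n),
    powerSum_eq_zero_add (abs_coeffJ_le (n + 1)), h]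
  simp only [coeffJ, Nat.factorial_succ]
  push_cast
  field_simp
  simp
  ring

theorem abs_radialJ_le (n : ℕ) (q : ℝ) : |radialJ n q| ≤ Real.exp |q| / n.factorial :=
  (abs_powerSum_le (abs_coeffJ_le n) q).trans_eq (by ring)

/-- The digamma series in `Y_n`. -/
def radialPsi (n : ℕ) (q : ℝ) : ℝ := powerSum (coeffPsi n) q

/-- The jump `ψ(i+2) = ψ(i+1) + 1/(i+1)` leaves an extra series, which is that of `radialJ n`
without its constant term, divided by `q`. In `radialY` it cancels against the derivatives of the
logarithm and of the pole. -/
theorem hasDerivAt_radialPsi (n : ℕ) {q : ℝ} (hq : q ≠ 0) :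
    HasDerivAt (radialPsi n)
      (-radialPsi (n + 1) q + (radialJ n q - 1 / n.factorial) / q) q := by
  refine (hasDerivAt_powerSum (abs_coeffPsi_le n) q).congr_deriv ?_
  have h1 : (radialJ n q - 1 / n.factorial) / q = powerSum (fun i => coeffJ n (i + 1)) q := by
    rw [radialJ, powerSum_eq_zero_add (abs_coeffJ_le n)]
    simp [coeffJ]
    field_simp
  have hb : ∀ i, |coeffJ n (i + 1)| ≤ (1 : ℝ) / i.factorial := by
    intro i
    refine (abs_coeffJ_le _ _).trans ?_
    rw [div_div]
    apply one_div_le_one_div_of_le (by positivity)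
    have h3 : (1 : ℝ) ≤ n.factorial := by exact_mod_cast Nat.factorial_pos _
    have h5 : (i.factorial : ℝ) ≤ (i + 1).factorial := by
      exact_mod_cast Nat.factorial_le (by omega)
    nlinarith [(by positivity : (0 : ℝ) < (i + 1).factorial)]
  rw [h1, radialPsi, neg_add_eq_sub, ← powerSum_sub hb (abs_coeffPsi_le (n + 1))]
  congr 1; ext i
  simp only [coeffJ, coeffPsi]
  rw [show n + (i + 1) = n + 1 + i by ring, Nat.factorial_succ i, psiSucc_succ]
  push_cast
  field_simp
  ring

/-- The digamma jumps cancel in every coefficient except the constant one; the defect left there is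
opposite to that of `radialPole` when both enter `radialY`. -/
theorem radialPsi_recurrence (n : ℕ) (q : ℝ) :
    radialPsi n q = (n + 1) * radialPsi (n + 1) q - q * radialPsi (n + 2) q
      - 1 / (n + 1).factorial := by
  have h : powerSum (fun i => coeffPsi n (i + 1)) q
      = (n + 1) * powerSum (fun i => coeffPsi (n + 1) (i + 1)) q
        - powerSum (coeffPsi (n + 2)) q := by
    have h1 : ∀ i, |(n + 1 : ℝ) * coeffPsi (n + 1) (i + 1)| ≤ ((n + 1) * 4) / i.factorial := by
      intro i
      rw [abs_mul, abs_of_nonneg (by positivity : (0 : ℝ) ≤ n + 1), mul_div_assoc]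
      gcongr
      refine (abs_coeffPsi_le _ _).trans ?_
      have h4 : i.factorial ≤ (i + 1).factorial := Nat.factorial_le (by omega)
      gcongr
    rw [← powerSum_const_mul, ← powerSum_sub h1 (abs_coeffPsi_le (n + 2))]
    congr 1; ext i
    simp only [coeffPsi]
    rw [show n + 1 + (i + 1) = n + i + 1 + 1 by ring, show n + 2 + i = n + i + 1 + 1 by ring,
      show n + (i + 1) = n + i + 1 by ring, Nat.factorial_succ i, Nat.factorial_succ (n + i + 1),
      psiSucc_succ (n + i + 1), psiSucc_succ i]
    push_cast
    field_simp
    ring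
  rw [radialPsi, radialPsi, radialPsi, powerSum_eq_zero_add (abs_coeffPsi_le n),
    powerSum_eq_zero_add (abs_coeffPsi_le (n + 1)), h]
  simp only [coeffPsi, Nat.factorial_succ, add_zero, psiSucc_succ n]
  push_cast
  field_simp
  simp
  ring

theorem abs_radialPsi_le (n : ℕ) (q : ℝ) : |radialPsi n q| ≤ 4 * Real.exp |q| :=
  abs_powerSum_le (abs_coeffPsi_le n) q

/-- The singular part of `Y_n`. -/
def radialPole (n : ℕ) (q : ℝ) : ℝ :=
  ∑ j ∈ Finset.range n, (j.factorial : ℝ) / (n - 1 - j).factorial * (q ^ (j + 1))⁻¹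

theorem hasDerivAt_radialPole (n : ℕ) {q : ℝ} (hq : q ≠ 0) :
    HasDerivAt (radialPole n) (-radialPole (n + 1) q + 1 / n.factorial / q) q := by
  have h : HasDerivAt (radialPole n) (∑ j ∈ Finset.range n,
      (j.factorial : ℝ) / (n - 1 - j).factorial * (-((j + 1 : ℕ) * q ^ j) / (q ^ (j + 1)) ^ 2)) q :=
    HasDerivAt.fun_sum fun j _ =>
      ((hasDerivAt_pow (j + 1) q).fun_inv (pow_ne_zero _ hq)).const_mul _
  refine h.congr_deriv ?_
  rw [radialPole, Finset.sum_range_succ', neg_add, ← Finset.sum_neg_distrib, add_assoc]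
  have h0 : -(((0 : ℕ).factorial : ℝ) / (n + 1 - 1 - 0).factorial * (q ^ (0 + 1))⁻¹)
      + 1 / n.factorial / q = 0 := by simp; field_simp; simp
  rw [h0, add_zero]
  refine Finset.sum_congr rfl fun j _ => ?_
  rw [show n + 1 - 1 - (j + 1) = n - 1 - j by omega, Nat.factorial_succ]
  push_cast
  field_simp
  ring

theorem radialPole_recurrence (n : ℕ) {q : ℝ} (hq : q ≠ 0) :
    radialPole n q = (n + 1) * radialPole (n + 1) q - q * radialPole (n + 2) q
      + 1 / (n + 1).factorial := by
  have h1 : q * radialPole (n + 2) q = ∑ j ∈ Finset.range (n + 1),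
      (j + 1) * ((j.factorial : ℝ) / (n - j).factorial * (q ^ (j + 1))⁻¹)
        + 1 / (n + 1).factorial := by
    rw [radialPole, Finset.sum_range_succ', mul_add, Finset.mul_sum]
    congr 1
    · refine Finset.sum_congr rfl fun j _ => ?_
      rw [show n + 2 - 1 - (j + 1) = n - j by omega, Nat.factorial_succ]
      push_cast
      field_simp
      ring
    · simp
      field_simp
  -- The range is enlarged by the index `j = n`, whose factor `n - j` vanishes, so that all three
  -- sums run over the same range.
  have h2 : radialPole n q = ∑ j ∈ Finset.range (n + 1),
      (n - j : ℝ) * ((j.factorial : ℝ) / (n - j).factorial * (q ^ (j + 1))⁻¹) := by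
    rw [Finset.sum_range_succ, sub_self, zero_mul, add_zero, radialPole]
    refine Finset.sum_congr rfl fun j hj => ?_
    have hj' : j < n := Finset.mem_range.mp hj
    obtain ⟨d, rfl⟩ := Nat.exists_eq_add_of_lt hj'
    rw [show j + d + 1 - 1 - j = d by omega, show j + d + 1 - j = d + 1 by omega,
      Nat.factorial_succ d]
    push_cast
    field_simp
    ring
  rw [h1, h2, radialPole, Finset.mul_sum, sub_add_eq_sub_sub, ← Finset.sum_sub_distrib,
    sub_add_cancel]
  refine Finset.sum_congr rfl fun j _ => ?_
  rw [show n + 1 - 1 - j = n - j by omega]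
  ring

theorem abs_radialPole_le (n : ℕ) {q : ℝ} (hq : 0 < q) :
    |radialPole n q| ≤ n.factorial * (q ^ n)⁻¹ * Real.exp q := by
  have h0 : radialPole n q = ∑ i ∈ Finset.range n,
      ((n - 1 - i).factorial : ℝ) * (q ^ n)⁻¹ * (q ^ i / i.factorial) := by
    rw [radialPole, ← Finset.sum_range_reflect]
    refine Finset.sum_congr rfl fun j hj => ?_
    have hj' : j < n := Finset.mem_range.mp hj
    obtain ⟨d, rfl⟩ := Nat.exists_eq_add_of_lt hj'
    rw [show j + d + 1 - 1 - (j + d + 1 - 1 - j) = j by omega,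
      show j + d + 1 - 1 - j = d by omega]
    field_simp
    ring
  rw [h0, abs_of_nonneg (Finset.sum_nonneg fun _ _ => by positivity)]
  calc _ ≤ ∑ i ∈ Finset.range n, (n.factorial : ℝ) * (q ^ n)⁻¹ * (q ^ i / i.factorial) := by
        refine Finset.sum_le_sum fun i _ => ?_
        have : (n - 1 - i).factorial ≤ n.factorial := Nat.factorial_le (by omega)
        gcongr
    _ = n.factorial * (q ^ n)⁻¹ * ∑ i ∈ Finset.range n, q ^ i / i.factorial := by
        rw [Finset.mul_sum]
    _ ≤ _ := by
        gcongr
        exact Real.sum_le_exp_of_nonneg hq.le n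

/-- `π Y_n(r) = (r / 2) ^ n * radialY n (r ^ 2 / 4)`. -/
def radialY (n : ℕ) (q : ℝ) : ℝ :=
  -radialPole n q + Real.log q * radialJ n q - radialPsi n q

/-- The inhomogeneous terms of the pole, the logarithm and the digamma series cancel, so `radialY`
obeys the same relation as `radialJ`; the recurrence below behaves likewise. Graf's theorem uses
nothing else about `Y`, apart from bounds. -/
theorem hasDerivAt_radialY (n : ℕ) {q : ℝ} (hq : q ≠ 0) :
    HasDerivAt (radialY n) (-radialY (n + 1) q) q := by
  refine (((hasDerivAt_radialPole n hq).neg.add ((Real.hasDerivAt_log hq).mul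
    (hasDerivAt_radialJ n q))).sub (hasDerivAt_radialPsi n hq)).congr_deriv ?_
  rw [radialY]
  field_simp
  ring

theorem radialY_recurrence (n : ℕ) {q : ℝ} (hq : q ≠ 0) :
    radialY n q = (n + 1) * radialY (n + 1) q - q * radialY (n + 2) q := by
  rw [radialY, radialY, radialY]
  linear_combination -radialPole_recurrence n hq + Real.log q * radialJ_recurrence n q
    - radialPsi_recurrence n q

/-- The pole dominates for large order. The regular parts are absorbed into it by `q ^ n / n! ≤ exp
q`, so that the remaining factor does not depend on `n`. -/
theorem abs_radialY_le (n : ℕ) {q : ℝ} (hq : 0 < q) :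
    |radialY n q| ≤ n.factorial * (q ^ n)⁻¹ *
      (Real.exp q + Real.exp q * (|Real.log q| + 4) * Real.exp q) := by
  have hJ := abs_radialJ_le n q
  have hP := abs_radialPsi_le n q
  have hS := abs_radialPole_le n hq
  rw [abs_of_pos hq] at hJ hP
  have h1 : (1 : ℝ) ≤ n.factorial := by exact_mod_cast Nat.factorial_pos _
  have hJ' : |radialJ n q| ≤ Real.exp q := hJ.trans (div_le_self (Real.exp_pos _).le h1)
  have h2 : 1 ≤ n.factorial * (q ^ n)⁻¹ * Real.exp q := by
    have := Real.pow_div_factorial_le_exp q hq.le n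
    rw [div_le_iff₀ (by positivity)] at this
    rw [mul_assoc, mul_comm (q ^ n)⁻¹, ← mul_assoc, ← div_eq_mul_inv, le_div_iff₀ (by positivity)]
    linarith
  have h3 : |radialY n q| ≤ |radialPole n q| + |Real.log q| * |radialJ n q| + |radialPsi n q| := by
    rw [radialY, ← abs_mul, ← abs_neg (radialPole n q)]
    exact (abs_sub _ _).trans (add_le_add_left (abs_add_le _ _) _)
  have h4 : |Real.log q| * |radialJ n q| ≤ |Real.log q| * Real.exp q := by gcongr
  have h5 : 0 ≤ Real.exp q * (|Real.log q| + 4) := by positivity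
  nlinarith [mul_le_mul_of_nonneg_left h2 h5]

theorem besselJNat_eq (n : ℕ) (r : ℝ) :
    besselJNat n r = (r / 2) ^ n * radialJ n (r ^ 2 / 4) := by
  rw [besselJNat, radialJ, powerSum]
  congr 2; ext i
  rw [coeffJ, neg_pow]
  ring

theorem besselYNat_eq (n : ℕ) {r : ℝ} (hr : 0 < r) :
    besselYNat n r = (r / 2) ^ n * (radialY n (r ^ 2 / 4) / Real.pi) := by
  have h1 : Real.log (r ^ 2 / 4) = 2 * Real.log (r / 2) := by
    rw [show r ^ 2 / 4 = (r / 2) ^ 2 by ring, Real.log_pow]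
    norm_num
  have h2 : (r / 2) ^ n * radialPole n (r ^ 2 / 4) = ((r / 2) ^ n)⁻¹ * ∑ i ∈ Finset.range n,
      ((n - 1 - i).factorial : ℝ) / (i.factorial : ℝ) * (r ^ 2 / 4) ^ i := by
    rw [radialPole, ← Finset.sum_range_reflect, Finset.mul_sum, Finset.mul_sum]
    refine Finset.sum_congr rfl fun j hj => ?_
    have hj' : j < n := Finset.mem_range.mp hj
    obtain ⟨d, rfl⟩ := Nat.exists_eq_add_of_lt hj'
    rw [show j + d + 1 - 1 - (j + d + 1 - 1 - j) = j by omega,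
      show j + d + 1 - 1 - j = d by omega, show r ^ 2 / 4 = (r / 2) ^ 2 by ring]
    have hs : r / 2 ≠ 0 := by positivity
    generalize r / 2 = s at hs
    field_simp
    ring
  have h3 : ∑' i : ℕ, (psiSucc i + psiSucc (n + i)) * (-(r ^ 2 / 4)) ^ i /
      ((i.factorial : ℝ) * ((n + i).factorial : ℝ)) = radialPsi n (r ^ 2 / 4) := by
    rw [radialPsi, powerSum]
    congr 1; ext i
    rw [coeffPsi, neg_pow]
    ring
  rw [besselYNat, h3, besselJNat_eq, radialY, h1]
  linear_combination h2 / Real.pi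

/-! ### Cylinder waves and their ladder relations -/

/-- The functions `f_m(z) = (z / 2) ^ m A_m(|z|² / 4)`, with `f_{-m} = (-1)^m (z̄ / 2) ^ m A_m`. -/
def ladder (A : ℕ → ℝ → ℂ) : ℤ → ℂ → ℂ
  | Int.ofNat n, z => (z / 2) ^ n * A n (Complex.normSq z / 4)
  | Int.negSucc n, z => (-1) ^ (n + 1) * (conj z / 2) ^ (n + 1) * A (n + 1) (Complex.normSq z / 4)

theorem norm_ladder (A : ℕ → ℝ → ℂ) (m : ℤ) (z : ℂ) :
    ‖ladder A m z‖ = (‖z‖ / 2) ^ m.natAbs * ‖A m.natAbs (‖z‖ ^ 2 / 4)‖ := by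
  cases m <;> simp [ladder, Complex.normSq_eq_norm_sq]

/-- In Wirtinger form, `∂f_m/∂z = f_{m-1}/2` and `∂f_m/∂z̄ = -f_{m+1}/2`. The derivative of `A`
raises the order, while the recurrence rewrites `A_n` where the order is lowered. The hypotheses are
needed only at the point reached at time `t`, so a singularity at `0` is allowed elsewhere. -/
theorem hasDerivAt_ladder {A : ℕ → ℝ → ℂ} {u v : ℂ} {t : ℝ}
    (hA : ∀ n, HasDerivAt (A n) (-A (n + 1) (Complex.normSq (u - t * v) / 4))
      (Complex.normSq (u - t * v) / 4))
    (hrec : ∀ n : ℕ, A n (Complex.normSq (u - t * v) / 4)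
      = (n + 1) * A (n + 1) (Complex.normSq (u - t * v) / 4)
        - (Complex.normSq (u - t * v) / 4 : ℝ) * A (n + 2) (Complex.normSq (u - t * v) / 4))
    (m : ℤ) :
    HasDerivAt (fun t : ℝ => ladder A m (u - t * v))
      (conj v / 2 * ladder A (m + 1) (u - t * v) - v / 2 * ladder A (m - 1) (u - t * v)) t := by
  have hz : HasDerivAt (fun t : ℝ => u - t * v) (-v) t := by
    simpa using ((Complex.ofRealCLM.hasDerivAt (x := t)).mul_const v).const_sub u
  have hzc : HasDerivAt (fun t : ℝ => conj (u - t * v)) (-conj v) t := by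
    simpa using ((Complex.ofRealCLM.hasDerivAt (x := t)).mul_const (conj v)).const_sub (conj u)
  have hq : HasDerivAt (fun t : ℝ => Complex.normSq (u - t * v) / 4)
      (-(v * conj (u - t * v) + conj v * (u - t * v)).re / 4) t := by
    have h1 := (hz.mul hzc)
    have h2 := (Complex.reCLM.hasFDerivAt.comp_hasDerivAt t h1).div_const 4
    refine (h2.congr_deriv ?_).congr_of_eventuallyEq (Filter.Eventually.of_forall fun s => ?_)
    · simp only [Complex.reCLM_apply]
      rw [← Complex.neg_re]
      congr 2
      ring
    · simp only [Function.comp, Pi.mul_apply, Complex.reCLM_apply, Complex.mul_conj, Complex.ofReal_re]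
  -- The argument of the real part is a number plus its conjugate, hence already real.
  have hq' : ((-(v * conj (u - t * v) + conj v * (u - t * v)).re / 4 : ℝ) : ℂ)
      = -(v * conj (u - t * v) + conj v * (u - t * v)) / 4 := by
    have : conj (v * conj (u - t * v) + conj v * (u - t * v))
        = v * conj (u - t * v) + conj v * (u - t * v) := by
      simp only [map_add, map_mul, Complex.conj_conj]
      ring
    have h3 := Complex.conj_eq_iff_re.mp this
    push_cast
    rw [h3]
  have hn : ((Complex.normSq (u - t * v) / 4 : ℝ) : ℂ) = (u - t * v) * conj (u - t * v) / 4 := by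
    push_cast
    rw [Complex.normSq_eq_conj_mul_self]
    ring
  have hAq : ∀ n, HasDerivAt (fun t : ℝ => A n (Complex.normSq (u - t * v) / 4))
      ((v * conj (u - t * v) + conj v * (u - t * v)) / 4 *
        A (n + 1) (Complex.normSq (u - t * v) / 4)) t := by
    intro n
    refine ((hA n).scomp t hq).congr_deriv ?_
    rw [Complex.real_smul, hq']
    ring
  rw [hn] at hrec
  generalize hgz : (u - t * v) = z at *
  -- Orders `0` and `-1` are separate cases: there one of the neighbouring orders passes from powers
  -- of `z` to powers of `z̄` or back.
  rcases m with n | n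
  · rcases n with _ | n
    · refine ((hAq 0).congr_deriv ?_).congr_of_eventuallyEq (Filter.Eventually.of_forall fun s => ?_)
      · change _ = _ / 2 * ((z / 2) ^ 1 * A 1 _) - _ / 2 * ((-1) ^ 1 * (conj z / 2) ^ 1 * A 1 _)
        ring
      · simp [ladder]
    · have h := ((hz.div_const 2).fun_pow (n + 1)).mul (hAq (n + 1))
      refine h.congr_deriv ?_
      change _ = _ / 2 * ((z / 2) ^ (n + 2) * A (n + 2) _) - _ / 2 * ladder A (((n + 1 : ℕ) : ℤ) - 1) _
      rw [show (((n + 1 : ℕ) : ℤ) - 1) = (n : ℤ) by push_cast; ring]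
      change _ = _ / 2 * ((z / 2) ^ (n + 2) * A (n + 2) _) - _ / 2 * ((z / 2) ^ n * A n _)
      rw [hrec n, hgz]
      push_cast
      ring
  · rcases n with _ | n
    · have h := ((hzc.div_const 2).mul (hAq 1)).neg
      refine (h.congr_deriv ?_).congr_of_eventuallyEq (Filter.Eventually.of_forall fun s => ?_)
      · change _ = _ / 2 * ((z / 2) ^ 0 * A 0 _) - _ / 2 * ((-1) ^ 2 * (conj z / 2) ^ 2 * A 2 _)
        have := hrec 0
        norm_num at this
        rw [this, hgz]
        ring
      · simp [ladder]
    · have h := (((hzc.div_const 2).fun_pow (n + 2)).mul (hAq (n + 2))).const_mul ((-1) ^ (n + 2))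
      refine (h.congr_deriv ?_).congr_of_eventuallyEq (Filter.Eventually.of_forall fun s => ?_)
      · rw [show Int.negSucc (n + 1) + 1 = Int.negSucc n by
            rw [Int.negSucc_eq, Int.negSucc_eq]; push_cast; ring,
          show Int.negSucc (n + 1) - 1 = Int.negSucc (n + 2) by
            rw [Int.negSucc_eq, Int.negSucc_eq]; push_cast; ring]
        simp only [ladder]
        have := hrec (n + 1)
        push_cast at this
        rw [show n + 1 + 1 = n + 2 by ring, show n + 1 + 2 = n + 3 by ring] at this
        rw [this, hgz]
        push_cast
        ring
      · simp [ladder, mul_assoc]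

/-- `radialJ` with complex values. -/
def radialJC (n : ℕ) (q : ℝ) : ℂ := radialJ n q

/-- `H_n^{(1)}(r) = (r / 2) ^ n * radialH n (r ^ 2 / 4)` for `r > 0`. -/
def radialH (n : ℕ) (q : ℝ) : ℂ := radialJ n q + Complex.I * (radialY n q / Real.pi : ℝ)

theorem hasDerivAt_ladder_radialJC (u v : ℂ) (t : ℝ) (m : ℤ) :
    HasDerivAt (fun t : ℝ => ladder radialJC m (u - t * v))
      (conj v / 2 * ladder radialJC (m + 1) (u - t * v)
        - v / 2 * ladder radialJC (m - 1) (u - t * v)) t := by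
  refine hasDerivAt_ladder (fun n => ?_) (fun n => ?_) m
  · refine (hasDerivAt_radialJ n _).ofReal_comp.congr_deriv ?_
    simp [radialJC]
  · simp only [radialJC]
    rw [radialJ_recurrence n]
    push_cast
    ring

theorem hasDerivAt_ladder_radialH {u v : ℂ} {t : ℝ} (h : u - t * v ≠ 0) (m : ℤ) :
    HasDerivAt (fun t : ℝ => ladder radialH m (u - t * v))
      (conj v / 2 * ladder radialH (m + 1) (u - t * v)
        - v / 2 * ladder radialH (m - 1) (u - t * v)) t := by
  have hq : Complex.normSq (u - t * v) / 4 ≠ 0 := by simpa using h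
  refine hasDerivAt_ladder (fun n => ?_) (fun n => ?_) m
  · have h1 := (hasDerivAt_radialJ n (Complex.normSq (u - t * v) / 4)).ofReal_comp
    have h2 := ((hasDerivAt_radialY n hq).div_const Real.pi).ofReal_comp.const_mul Complex.I
    refine (h1.add h2).congr_deriv ?_
    simp only [radialH]
    push_cast
    ring
  · simp only [radialH]
    have h1 := radialJ_recurrence n (Complex.normSq (u - t * v) / 4)
    have h2 := radialY_recurrence n hq
    rw [h1, h2]
    push_cast
    ring

/-- `e^{i m θ}` as a power of the unit vector. -/
theorem norm_pow_mul_angExp (n : ℕ) (z : ℂ) : (‖z‖ : ℂ) ^ n * angExp n z = z ^ n := by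
  conv_rhs => rw [← Complex.norm_mul_exp_arg_mul_I z]
  rw [mul_pow, ← Complex.exp_nat_mul, angExp]
  congr 2
  push_cast
  ring

theorem conj_angExp (m : ℤ) (z : ℂ) : conj (angExp m z) = angExp (-m) z := by
  rw [angExp, angExp, ← Complex.exp_conj]
  congr 1
  simp

theorem intOrder_mul_angExp {B : ℕ → ℝ → ℝ} {A : ℕ → ℝ → ℝ} {z : ℂ}
    (h : ∀ n, B n ‖z‖ = (‖z‖ / 2) ^ n * A n (‖z‖ ^ 2 / 4)) (m : ℤ) :
    (intOrder B m ‖z‖ : ℂ) * angExp m z = ladder (fun n q => (A n q : ℂ)) m z := by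
  rcases m with n | n
  · simp only [intOrder, ladder, h, Complex.normSq_eq_norm_sq, div_pow]
    rw [← norm_pow_mul_angExp n z]
    push_cast
    simp only [Int.ofNat_eq_natCast]
    ring
  · have h1 := congrArg conj (norm_pow_mul_angExp (n + 1) z)
    rw [map_mul, conj_angExp, map_pow, Complex.conj_ofReal, map_pow] at h1
    simp only [intOrder, ladder, h, Complex.normSq_eq_norm_sq, div_pow]
    rw [← h1]
    push_cast
    simp only [Int.negSucc_eq]
    ring

theorem besselJ_mul_angExp (m : ℤ) (z : ℂ) :
    besselJ m ‖z‖ * angExp m z = ladder radialJC m z :=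
  intOrder_mul_angExp (fun n => besselJNat_eq n ‖z‖) m

theorem hankelH_mul_angExp (m : ℤ) {z : ℂ} (hz : z ≠ 0) :
    hankelH m ‖z‖ * angExp m z = ladder radialH m z := by
  have h1 := besselJ_mul_angExp m z
  have h2 : besselY m ‖z‖ * angExp m z = _ :=
    intOrder_mul_angExp (A := fun n q => radialY n q / Real.pi)
      (fun n => besselYNat_eq n (norm_pos_iff.mpr hz)) m
  rw [hankelH, add_mul, mul_assoc, h1, h2]
  rcases m with n | n <;> simp only [ladder, radialH, radialJC] <;> ring

/-! ### Sums over the integers -/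

theorem sum_Icc_neg_succ {M : Type*} [AddCommMonoid M] (f : ℤ → M) (N : ℕ) :
    ∑ n ∈ Finset.Icc (-((N + 1 : ℕ) : ℤ)) ((N + 1 : ℕ) : ℤ), f n
      = f (-((N + 1 : ℕ) : ℤ)) + (f ((N + 1 : ℕ) : ℤ) + ∑ n ∈ Finset.Icc (-(N : ℤ)) N, f n) := by
  rw [← Finset.sum_insert, ← Finset.sum_insert]
  · congr 1
    ext n
    simp only [Finset.mem_Icc, Finset.mem_insert]
    omega
  · simp only [Finset.mem_Icc, Finset.mem_insert]
    omega
  · simp only [Finset.mem_Icc]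
    omega

theorem sum_Icc_neg_sub (f : ℤ → ℂ) (N : ℕ) :
    ∑ n ∈ Finset.Icc (-(N : ℤ)) N, (f (n + 1) - f n) = f (N + 1) - f (-N) := by
  induction N with
  | zero => simp
  | succ N ih =>
    rw [sum_Icc_neg_succ, ih]
    push_cast
    rw [show -((N : ℤ) + 1) + 1 = -N by ring]
    ring

theorem tendsto_Icc_neg : Filter.Tendsto (fun N : ℕ => Finset.Icc (-(N : ℤ)) N)
    Filter.atTop Filter.atTop := by
  refine Filter.tendsto_atTop_finset_of_monotone (fun a b h => ?_) fun n => ⟨n.natAbs, ?_⟩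
  · exact Finset.Icc_subset_Icc (by omega) (by omega)
  · simp only [Finset.mem_Icc]
    omega

theorem summable_comp_natAbs {g : ℕ → ℝ} (hg : Summable g) :
    Summable fun n : ℤ => g n.natAbs :=
  Summable.of_nat_of_neg (by simpa using hg) (by simpa using hg)

theorem tsum_eq_sum_Icc_add {f : ℤ → ℂ} (hf : Summable f) (p : ℕ) :
    ∑' n, f n = ∑ n ∈ Finset.Icc (-(p : ℤ)) p, f n
      + ((∑' i : ℕ, f ((p : ℤ) + 1 + i)) + ∑' i : ℕ, f (-(p : ℤ) - 1 - i)) := by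
  have h1 : Summable fun n : ℕ => f n := hf.comp_injective Nat.cast_injective
  have h2 : Summable fun n : ℕ => f (-(n + 1 : ℤ)) :=
    hf.comp_injective (i := fun n : ℕ => -(n + 1 : ℤ)) fun a b h => by simpa using h
  have h3 : ∑ n ∈ Finset.Icc (-(p : ℤ)) p, f n
      = ∑ n ∈ Finset.range (p + 1), f n + ∑ n ∈ Finset.range p, f (-(n + 1 : ℤ)) := by
    induction p with
    | zero => simp
    | succ p ih =>
      rw [sum_Icc_neg_succ, ih, Finset.sum_range_succ (fun n : ℕ => f n) (p + 1),
        Finset.sum_range_succ (fun n : ℕ => f (-(n + 1 : ℤ))) p]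
      push_cast
      ring
  rw [tsum_of_nat_of_neg_add_one h1 h2, ← h1.sum_add_tsum_nat_add (p + 1),
    ← h2.sum_add_tsum_nat_add p, h3]
  have h4 : ∀ i : ℕ, f ((i + (p + 1) : ℕ) : ℤ) = f ((p : ℤ) + 1 + i) := fun i => by
    congr 1; push_cast; ring
  have h5 : ∀ i : ℕ, f (-(((i + p : ℕ) : ℤ) + 1)) = f (-(p : ℤ) - 1 - i) := fun i => by
    congr 1; push_cast; ring
  simp only [h4, h5]
  ring

/-! ### Graf's addition theorem -/

theorem ladder_zero (A : ℕ → ℝ → ℂ) (n : ℤ) : ladder A n 0 = if n = 0 then A 0 0 else 0 := by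
  rcases n with n | n
  · rcases n with _ | n
    · simp [ladder]
    · have : (n : ℤ) + 1 ≠ 0 := by omega
      simp [ladder, this]
  · simp [ladder]

theorem radialJC_zero_zero : radialJC 0 0 = 1 := by
  simp only [radialJC, radialJ]
  rw [powerSum_eq_zero_add (abs_coeffJ_le 0)]
  simp [coeffJ]

/-- The pairing `∑ c_n(t) G_{m+n}(t)` is constant in `t`, because the ladder relations of `c` and
`G` make its derivative telescope. The bound is required for every `m`, as the boundary terms
involve the orders `m + 1` and `m - 1`. -/
theorem hasSum_of_ladder_relation {v : ℂ} {G : ℤ → ℝ → ℂ}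
    (hG : ∀ m, ∀ t ∈ Set.Icc (0 : ℝ) 1,
      HasDerivAt (G m) (conj v / 2 * G (m + 1) t - v / 2 * G (m - 1) t) t)
    (hb : ∀ m, ∃ b : ℤ → ℝ, Summable b ∧ ∀ t ∈ Set.Icc (0 : ℝ) 1, ∀ n,
      ‖ladder radialJC n (v - t * v)‖ * ‖G (m + n) t‖ ≤ b n) (m : ℤ) :
    HasSum (fun n => conj (ladder radialJC n v) * G (m + n) 0) (G m 1) := by
  set c : ℤ → ℝ → ℂ := fun n t => conj (ladder radialJC n (v - t * v)) with hc
  have hnc : ∀ n t, ‖c n t‖ = ‖ladder radialJC n (v - t * v)‖ := fun n t => by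
    simp [hc]
  have hcd : ∀ n t, HasDerivAt (c n) (v / 2 * c (n + 1) t - conj v / 2 * c (n - 1) t) t := by
    intro n t
    have := (hasDerivAt_ladder_radialJC v v t n).star
    refine this.congr_deriv ?_
    simp [hc]
  obtain ⟨b, hbs, hbb⟩ := hb m
  obtain ⟨b₁, hbs₁, hbb₁⟩ := hb (m + 1)
  obtain ⟨b₂, hbs₂, hbb₂⟩ := hb (m - 1)
  -- The flux: the derivative of the `n`-th term is `h t (n + 1) - h t n`.
  set h : ℝ → ℤ → ℂ := fun t n => conj v / 2 * (c (n - 1) t * G (m + n) t)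
    + v / 2 * (c n t * G (m + n - 1) t) with hh
  set e : ℤ → ℝ := fun n => ‖v‖ / 2 * b₁ (n - 1) + ‖v‖ / 2 * b₂ n with he
  have hhe : ∀ t ∈ Set.Icc (0 : ℝ) 1, ∀ n, ‖h t n‖ ≤ e n := by
    intro t ht n
    have h1 := hbb₁ t ht (n - 1)
    have h2 := hbb₂ t ht n
    rw [show m + 1 + (n - 1) = m + n by ring, ← hnc] at h1
    rw [show m - 1 + n = m + n - 1 by ring, ← hnc] at h2
    refine (norm_add_le _ _).trans ?_
    simp only [norm_mul, norm_div, RCLike.norm_conj, RCLike.norm_ofNat, he]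
    gcongr
  have hS : ∀ N : ℕ, ∀ t ∈ Set.Icc (0 : ℝ) 1,
      HasDerivAt (fun t => ∑ n ∈ Finset.Icc (-(N : ℤ)) N, c n t * G (m + n) t)
        (h t (N + 1) - h t (-N)) t := by
    intro N t ht
    refine (HasDerivAt.fun_sum fun n _ => (hcd n t).mul (hG (m + n) t ht)).congr_deriv ?_
    rw [← sum_Icc_neg_sub]
    refine Finset.sum_congr rfl fun n _ => ?_
    simp only [hh]
    rw [add_sub_cancel_right, ← add_assoc, add_sub_cancel_right]
    ring
  -- At `t = 1` the coefficients are `J`-waves at the origin, which vanish except for `n = 0`.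
  have hS1 : ∀ N : ℕ, ∑ n ∈ Finset.Icc (-(N : ℤ)) N, c n 1 * G (m + n) 1 = G m 1 := by
    intro N
    rw [Finset.sum_eq_single 0]
    · simp [hc, ladder_zero, radialJC_zero_zero]
    · intro n _ hn
      simp [hc, ladder_zero, hn]
    · simp
  have hle : ∀ N : ℕ, ‖G m 1 - ∑ n ∈ Finset.Icc (-(N : ℤ)) N, c n 0 * G (m + n) 0‖
      ≤ e (N + 1) + e (-N) := by
    intro N
    rw [← hS1 N]
    refine norm_image_sub_le_of_norm_deriv_le_segment_01'
      (fun t ht => (hS N t ht).hasDerivWithinAt) fun t ht => ?_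
    have ht' := Set.Ico_subset_Icc_self ht
    exact (norm_sub_le _ _).trans (add_le_add (hhe t ht' _) (hhe t ht' _))
  have he0 : Filter.Tendsto (fun N : ℕ => e (N + 1) + e (-N)) Filter.atTop (nhds 0) := by
    have hes : Summable e := ((hbs₁.comp_injective (i := fun n => n - 1)
      (sub_left_injective)).mul_left _).add (hbs₂.mul_left _)
    have h1 : Summable fun N : ℕ => e (N + 1) :=
      hes.comp_injective (i := fun N : ℕ => (N : ℤ) + 1) fun a b h => by simpa using h
    have h2 : Summable fun N : ℕ => e (-N) :=
      hes.comp_injective (i := fun N : ℕ => -(N : ℤ)) fun a b h => by simpa using h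
    simpa using h1.tendsto_atTop_zero.add h2.tendsto_atTop_zero
  have hlim : Filter.Tendsto (fun N : ℕ => ∑ n ∈ Finset.Icc (-(N : ℤ)) N, c n 0 * G (m + n) 0)
      Filter.atTop (nhds (G m 1)) := by
    rw [tendsto_iff_norm_sub_tendsto_zero]
    refine squeeze_zero (fun _ => norm_nonneg _) (fun N => ?_) he0
    rw [norm_sub_rev]
    exact hle N
  have hsum : Summable fun n => c n 0 * G (m + n) 0 := by
    refine Summable.of_norm_bounded hbs fun n => ?_
    rw [norm_mul, hnc]
    exact hbb 0 (by simp) n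
  have := tendsto_nhds_unique (hsum.hasSum.comp tendsto_Icc_neg) hlim
  have h' := hsum.hasSum
  rw [this] at h'
  simpa [hc] using h'

theorem norm_ladder_radialJC_le (m : ℤ) (z : ℂ) :
    ‖ladder radialJC m z‖ ≤ Real.exp (‖z‖ ^ 2 / 4) * ((‖z‖ / 2) ^ m.natAbs / m.natAbs.factorial) := by
  rw [norm_ladder, radialJC, Complex.norm_real, Real.norm_eq_abs]
  have := abs_radialJ_le m.natAbs (‖z‖ ^ 2 / 4)
  rw [abs_of_nonneg (by positivity : 0 ≤ ‖z‖ ^ 2 / 4)] at this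
  calc _ ≤ (‖z‖ / 2) ^ m.natAbs * (Real.exp (‖z‖ ^ 2 / 4) / m.natAbs.factorial) := by gcongr
    _ = _ := by ring

theorem norm_sub_real_mul_self {v : ℂ} {t : ℝ} (ht : t ∈ Set.Icc (0 : ℝ) 1) :
    ‖v - t * v‖ = (1 - t) * ‖v‖ := by
  rw [show v - t * v = ((1 - t : ℝ) : ℂ) * v by push_cast; ring, norm_mul, Complex.norm_real,
    Real.norm_of_nonneg (by linarith [ht.2])]

/-- The factorial in the bound for `J_n` already gives summability; the shifted factor is bounded
uniformly in its order by `x ^ k / k! ≤ exp x`. -/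
theorem hasSum_ladder_radialJC (m : ℤ) (u v : ℂ) :
    HasSum (fun n => conj (ladder radialJC n v) * ladder radialJC (m + n) u)
      (ladder radialJC m (u - v)) := by
  have h := hasSum_of_ladder_relation (v := v) (G := fun m t => ladder radialJC m (u - t * v))
    (fun m t _ => hasDerivAt_ladder_radialJC u v t m) (fun m => ?_) m
  · simpa using h
  set r := ‖u‖ + ‖v‖
  refine ⟨fun n => Real.exp (‖v‖ ^ 2 / 4) * ((‖v‖ / 2) ^ n.natAbs / n.natAbs.factorial) *
    (Real.exp (r ^ 2 / 4) * Real.exp (r / 2)), ?_, fun t ht n => ?_⟩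
  · exact summable_comp_natAbs (g := fun n => Real.exp (‖v‖ ^ 2 / 4) * ((‖v‖ / 2) ^ n / n.factorial) *
      (Real.exp (r ^ 2 / 4) * Real.exp (r / 2)))
      (((Real.summable_pow_div_factorial _).mul_left _).mul_right _)
  · have h1 : ‖v - t * v‖ ≤ ‖v‖ := by
      rw [norm_sub_real_mul_self ht]
      nlinarith [ht.1, norm_nonneg v]
    have h2 : ‖u - t * v‖ ≤ r := by
      refine (norm_sub_le _ _).trans ?_
      rw [norm_mul, Complex.norm_real, Real.norm_of_nonneg ht.1]
      simp only [r]
      nlinarith [ht.2, norm_nonneg v]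
    have h3 := Real.pow_div_factorial_le_exp (r / 2) (by positivity) (m + n).natAbs
    refine mul_le_mul ((norm_ladder_radialJC_le _ _).trans (by gcongr))
      ((norm_ladder_radialJC_le _ _).trans ?_) (norm_nonneg _) (by positivity)
    gcongr
    exact le_trans (by gcongr) h3

theorem norm_radialH_le (n : ℕ) {q : ℝ} (hq : 0 < q) :
    ‖radialH n q‖ ≤ n.factorial * (q ^ n)⁻¹ *
      (Real.exp q * Real.exp q + (Real.exp q + Real.exp q * (|Real.log q| + 4) * Real.exp q)) := by
  have hJ := abs_radialJ_le n q
  rw [abs_of_pos hq] at hJ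
  have h1 : (1 : ℝ) ≤ n.factorial := by exact_mod_cast Nat.factorial_pos _
  have hJ' : |radialJ n q| ≤ Real.exp q := hJ.trans (div_le_self (Real.exp_pos _).le h1)
  have h2 : 1 ≤ n.factorial * (q ^ n)⁻¹ * Real.exp q := by
    have := Real.pow_div_factorial_le_exp q hq.le n
    rw [div_le_iff₀ (by positivity)] at this
    rw [mul_assoc, mul_comm (q ^ n)⁻¹, ← mul_assoc, ← div_eq_mul_inv, le_div_iff₀ (by positivity)]
    linarith
  have h3 : |radialY n q / Real.pi| ≤ |radialY n q| := by
    rw [abs_div, abs_of_pos Real.pi_pos]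
    exact div_le_self (abs_nonneg _) (by linarith [Real.pi_gt_three])
  rw [radialH]
  refine (norm_add_le _ _).trans ?_
  rw [norm_mul, Complex.norm_I, one_mul, Complex.norm_real, Complex.norm_real, Real.norm_eq_abs,
    Real.norm_eq_abs]
  have h4 := abs_radialY_le n hq
  nlinarith [mul_le_mul_of_nonneg_right h2 (Real.exp_pos q).le]

theorem norm_ladder_radialH_le (m : ℤ) {z : ℂ} (hz : z ≠ 0) :
    ‖ladder radialH m z‖ ≤ m.natAbs.factorial * (2 / ‖z‖) ^ m.natAbs *
      (Real.exp (‖z‖ ^ 2 / 4) * Real.exp (‖z‖ ^ 2 / 4) + (Real.exp (‖z‖ ^ 2 / 4) +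
        Real.exp (‖z‖ ^ 2 / 4) * (|Real.log (‖z‖ ^ 2 / 4)| + 4) * Real.exp (‖z‖ ^ 2 / 4))) := by
  have hz' : 0 < ‖z‖ := norm_pos_iff.mpr hz
  rw [norm_ladder]
  refine (mul_le_mul_of_nonneg_left (norm_radialH_le _ (by positivity)) (by positivity)).trans_eq ?_
  rw [← mul_assoc]
  congr 1
  rw [show ‖z‖ ^ 2 / 4 = (‖z‖ / 2) ^ 2 by ring, show 2 / ‖z‖ = (‖z‖ / 2)⁻¹ by simp]
  have : ‖z‖ / 2 ≠ 0 := by positivity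
  generalize ‖z‖ / 2 = s at this
  rw [← pow_mul, mul_comm 2, pow_mul, inv_pow]
  field_simp

/-- Since `|m + n|` may exceed or fall below `|n|`, by at most `|m|`, both `a` and its inverse must
be controlled. -/
theorem pow_natAbs_add_le {a K : ℝ} (ha : 0 < a) (h1 : 1 ≤ K) (haK : a ≤ K) (haK' : a⁻¹ ≤ K)
    (m n : ℤ) : a ^ (m + n).natAbs ≤ K ^ m.natAbs * a ^ n.natAbs := by
  rcases le_total n.natAbs (m + n).natAbs with h | h
  · obtain ⟨d, hd⟩ := Nat.exists_eq_add_of_le h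
    rw [hd, pow_add, mul_comm]
    gcongr
    calc a ^ d ≤ K ^ d := by gcongr
      _ ≤ K ^ m.natAbs := pow_le_pow_right₀ h1 (by omega)
  · obtain ⟨d, hd⟩ := Nat.exists_eq_add_of_le h
    rw [hd, pow_add, ← mul_assoc, mul_right_comm]
    refine le_mul_of_one_le_left (by positivity) ?_
    calc (1 : ℝ) = a⁻¹ ^ d * a ^ d := by rw [← mul_pow, inv_mul_cancel₀ ha.ne', one_pow]
      _ ≤ K ^ m.natAbs * a ^ d := by
        gcongr
        calc a⁻¹ ^ d ≤ K ^ d := by gcongr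
          _ ≤ K ^ m.natAbs := pow_le_pow_right₀ h1 (by omega)

theorem factorial_natAbs_add_le (m n : ℤ) : (m + n).natAbs.factorial
    ≤ n.natAbs.factorial * (n.natAbs + m.natAbs) ^ m.natAbs := by
  calc (m + n).natAbs.factorial ≤ (n.natAbs + m.natAbs).factorial := Nat.factorial_le (by omega)
    _ = n.natAbs.factorial * (n.natAbs + 1).ascFactorial m.natAbs :=
      (Nat.factorial_mul_ascFactorial _ _).symm
    _ ≤ _ := by
      gcongr
      exact Nat.ascFactorial_le_pow_add _ _

theorem summable_add_pow_mul_geometric {ρ : ℝ} (h0 : 0 < ρ) (h1 : ρ < 1) (M : ℕ) :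
    Summable fun n : ℕ => ((n : ℝ) + M) ^ M * ρ ^ n := by
  have h := summable_pow_mul_geometric_of_norm_lt_one M (r := ρ)
    (by rwa [Real.norm_of_nonneg h0.le])
  refine (((summable_nat_add_iff M).mpr h).mul_left (ρ ^ M)⁻¹).congr fun n => ?_
  push_cast
  rw [pow_add]
  field_simp

/-- The factorial growth of `H_{m+n}` cancels the factorial decay of `J_n`, up to a power of `n` of
degree `|m|`. What remains is geometric, with ratio at most some `ρ < 1` on the whole segment. -/
theorem hasSum_ladder_radialH (m : ℤ) {u v : ℂ} (huv : ‖v‖ < ‖u‖) :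
    HasSum (fun n => conj (ladder radialJC n v) * ladder radialH (m + n) u)
      (ladder radialH m (u - v)) := by
  have hlow : ∀ t ∈ Set.Icc (0 : ℝ) 1, ‖u‖ - t * ‖v‖ ≤ ‖u - t * v‖ := fun t ht => by
    have := norm_sub_norm_le u (t * v)
    rwa [norm_mul, Complex.norm_real, Real.norm_of_nonneg ht.1] at this
  have hup : ∀ t ∈ Set.Icc (0 : ℝ) 1, ‖u - t * v‖ ≤ ‖u‖ + ‖v‖ := fun t ht => by
    refine (norm_sub_le _ _).trans ?_
    rw [norm_mul, Complex.norm_real, Real.norm_of_nonneg ht.1]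
    nlinarith [ht.2, norm_nonneg v]
  have hpos : ∀ t ∈ Set.Icc (0 : ℝ) 1, ‖u‖ - ‖v‖ ≤ ‖u - t * v‖ := fun t ht => by
    refine le_trans ?_ (hlow t ht)
    nlinarith [ht.2, norm_nonneg v]
  have hne : ∀ t ∈ Set.Icc (0 : ℝ) 1, u - t * v ≠ 0 := fun t ht =>
    norm_pos_iff.mp ((sub_pos.mpr huv).trans_le (hpos t ht))
  have h := hasSum_of_ladder_relation (v := v) (G := fun m t => ladder radialH m (u - t * v))
    (fun m t ht => hasDerivAt_ladder_radialH (hne t ht) m) (fun m => ?_) m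
  · simpa using h
  have hu : 0 < ‖u‖ := (norm_nonneg v).trans_lt huv
  obtain ⟨ρ, hρ, hρ1⟩ := exists_between ((div_lt_one hu).mpr huv)
  have hρ0 : 0 < ρ := (by positivity : 0 ≤ ‖v‖ / ‖u‖).trans_lt hρ
  rw [div_lt_iff₀ hu] at hρ
  -- The segment stays away from the origin, so the prefactor containing the logarithm is bounded by
  -- compactness.
  have hcont : ContinuousOn (fun q : ℝ => Real.exp q * Real.exp q + (Real.exp q +
      Real.exp q * (|Real.log q| + 4) * Real.exp q))
      (Set.Icc ((‖u‖ - ‖v‖) ^ 2 / 4) ((‖u‖ + ‖v‖) ^ 2 / 4)) := by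
    have : ContinuousOn Real.log (Set.Icc ((‖u‖ - ‖v‖) ^ 2 / 4) ((‖u‖ + ‖v‖) ^ 2 / 4)) := by
      refine Real.continuousOn_log.mono fun q hq => ?_
      have : 0 < (‖u‖ - ‖v‖) ^ 2 / 4 := by
        have := sub_pos.mpr huv
        positivity
      exact (this.trans_le hq.1).ne'
    have := this.abs
    fun_prop
  obtain ⟨C, hC⟩ := isCompact_Icc.exists_bound_of_continuousOn hcont
  set a := ‖u‖ - ‖v‖
  set b := ‖u‖ + ‖v‖
  have ha : 0 < a := sub_pos.mpr huv
  have hC0 : 0 ≤ C := (norm_nonneg _).trans (hC (b ^ 2 / 4) (by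
    constructor
    · have : a ≤ b := by simp only [a, b]; linarith [norm_nonneg v]
      gcongr
    · exact le_rfl))
  set K := 1 + 2 / a + b / 2
  have hb0 : 0 ≤ b := by positivity
  have ha2 : 0 < 2 / a := by positivity
  refine ⟨fun n => Real.exp (‖v‖ ^ 2 / 4) * K ^ m.natAbs * C *
    ((((n.natAbs : ℕ) : ℝ) + m.natAbs) ^ m.natAbs * ρ ^ n.natAbs), ?_, fun t ht n => ?_⟩
  · exact summable_comp_natAbs (g := fun n => Real.exp (‖v‖ ^ 2 / 4) * K ^ m.natAbs * C *
      (((n : ℝ) + m.natAbs) ^ m.natAbs * ρ ^ n))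
      ((summable_add_pow_mul_geometric hρ0 hρ1 _).mul_left _)
  set z := u - t * v
  have hz : 0 < ‖z‖ := norm_pos_iff.mpr (hne t ht)
  have h1 := norm_ladder_radialJC_le n (v - t * v)
  have h2 := norm_ladder_radialH_le (m + n) (hne t ht)
  have h3 := hC (‖z‖ ^ 2 / 4) ⟨by have := hpos t ht; gcongr, by have := hup t ht; gcongr⟩
  have h3' := (le_abs_self _).trans h3
  -- From `‖v‖ ≤ ρ ‖u‖` one gets `ρ (‖u‖ - t ‖v‖) ≥ (1 - ρ t) ‖v‖ ≥ (1 - t) ‖v‖`.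
  have h4 : ‖v - t * v‖ ≤ ρ * ‖z‖ := by
    rw [norm_sub_real_mul_self ht]
    have := mul_le_mul_of_nonneg_left (hlow t ht) hρ0.le
    nlinarith [mul_nonneg (mul_nonneg ht.1 (norm_nonneg v)) (sub_nonneg.mpr hρ1.le)]
  have h5 : ‖v - t * v‖ ≤ ‖v‖ := by
    rw [norm_sub_real_mul_self ht]
    nlinarith [ht.1, norm_nonneg v]
  have h6 : (2 / ‖z‖) ^ (m + n).natAbs ≤ K ^ m.natAbs * (2 / ‖z‖) ^ n.natAbs := by
    refine pow_natAbs_add_le (by positivity) ?_ ?_ ?_ m n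
    · simp only [K]; linarith
    · have : 2 / ‖z‖ ≤ 2 / a := by have := hpos t ht; gcongr
      simp only [K]; linarith
    · rw [inv_div]
      have := hup t ht
      simp only [K]; linarith
  have h7 : ((m + n).natAbs.factorial : ℝ)
      ≤ n.natAbs.factorial * ((n.natAbs : ℝ) + m.natAbs) ^ m.natAbs := by
    exact_mod_cast factorial_natAbs_add_le m n
  have h8 : (‖v - t * v‖ / 2) ^ n.natAbs ≤ (ρ * ‖z‖ / 2) ^ n.natAbs := by gcongr
  calc _ ≤ (Real.exp (‖v‖ ^ 2 / 4) * ((ρ * ‖z‖ / 2) ^ n.natAbs / n.natAbs.factorial)) *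
        ((n.natAbs.factorial * ((n.natAbs : ℝ) + m.natAbs) ^ m.natAbs) *
          (K ^ m.natAbs * (2 / ‖z‖) ^ n.natAbs) * C) := by
        refine mul_le_mul (h1.trans ?_) (h2.trans ?_) (norm_nonneg _) (by positivity)
        · gcongr
        · refine mul_le_mul (mul_le_mul h7 h6 (by positivity) (by positivity)) h3'
            (by positivity) (by positivity)
    _ = Real.exp (‖v‖ ^ 2 / 4) * K ^ m.natAbs * C *
        (((n.natAbs : ℝ) + m.natAbs) ^ m.natAbs * ((ρ * ‖z‖ / 2) * (2 / ‖z‖)) ^ n.natAbs) := by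
        rw [mul_pow _ (2 / ‖z‖)]
        have : (n.natAbs.factorial : ℝ) ≠ 0 := by positivity
        field_simp
    _ = _ := by
        rw [show ρ * ‖z‖ / 2 * (2 / ‖z‖) = ρ by field_simp]

theorem conj_besselJ (n : ℤ) (r : ℝ) : conj (besselJ n r) = besselJ n r := Complex.conj_ofReal _

/-- Graf's addition theorem for `J`. -/
theorem hasSum_grafTerm_besselJ (m : ℤ) (u v : ℂ) :
    HasSum (grafTerm besselJ 1 m u v) (besselJ m ‖u - v‖ * angExp m (u - v)) := by
  rw [besselJ_mul_angExp]
  convert hasSum_ladder_radialJC m u v using 1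
  ext n
  rw [← besselJ_mul_angExp, ← besselJ_mul_angExp, grafTerm, map_mul, conj_angExp, conj_besselJ,
    one_mul, one_mul]
  ring

theorem grafTerm_besselJ_neg (m : ℤ) (u v : ℂ) (n : ℤ) :
    grafTerm besselJ (-1) m u v n = conj (grafTerm besselJ 1 m u v n) := by
  simp only [grafTerm, map_mul, conj_angExp, conj_besselJ]
  simp

theorem hasSum_grafTerm_besselJ_neg (m : ℤ) (u v : ℂ) :
    HasSum (grafTerm besselJ (-1) m u v) (besselJ m ‖u - v‖ * angExp (-m) (u - v)) := by
  have h := (hasSum_grafTerm_besselJ m u v).star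
  simp only [star_mul', RCLike.star_def, conj_angExp, conj_besselJ] at h
  convert h using 1
  ext n
  rw [grafTerm_besselJ_neg]

/-- Graf's addition theorem for `H^{(1)}`. -/
theorem hasSum_grafTerm_hankelH (m : ℤ) {u v : ℂ} (h : ‖v‖ < ‖u‖) :
    HasSum (grafTerm hankelH 1 m u v) (hankelH m ‖u - v‖ * angExp m (u - v)) := by
  have hu : u ≠ 0 := norm_pos_iff.mp ((norm_nonneg v).trans_lt h)
  have huv : u - v ≠ 0 := fun h0 => by
    rw [sub_eq_zero.mp h0] at h
    exact lt_irrefl _ h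
  rw [hankelH_mul_angExp m huv]
  convert hasSum_ladder_radialH m h using 1
  ext n
  rw [← besselJ_mul_angExp, ← hankelH_mul_angExp _ hu, grafTerm, map_mul, conj_angExp, conj_besselJ,
    one_mul, one_mul]
  ring

/-- A convergent Graf series is its truncation plus the remainder. -/
theorem sum_add_grafRemainder {B : ℤ → ℝ → ℂ} {σ m : ℤ} {u v s : ℂ}
    (h : HasSum (grafTerm B σ m u v) s) (p : ℕ) :
    s = ∑ n ∈ Finset.Icc (-(p : ℤ)) p, grafTerm B σ m u v n + grafRemainder B σ m p u v := by
  rw [← h.tsum_eq, tsum_eq_sum_Icc_add h.summable p]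
  rfl

/-! ### Geometry of dyadic cells -/

namespace FMM

variable {N : ℕ}

/-- The cell of level `L` that contains `z`. -/
def cellAt (F : FMM N) (L : ℕ) (z : ℂ) : Cell :=
  ⟨L, ⌊(z - F.corner).re / F.width L⌋, ⌊(z - F.corner).im / F.width L⌋⟩

theorem width_pos {F : FMM N} (h : 0 < F.side) (L : ℕ) : 0 < F.width L := by
  unfold width
  positivity

theorem width_eq_two_mul (F : FMM N) (L : ℕ) : F.width L = 2 * F.width (L + 1) := by
  unfold width
  rw [pow_succ]
  field_simp

theorem width_eq_pow_mul (F : FMM N) (L d : ℕ) : F.width L = 2 ^ d * F.width (L + d) := by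
  unfold width
  rw [pow_add]
  field_simp

theorem mem_region_iff {F : FMM N} (h : 0 < F.side) {C : Cell} {z : ℂ} :
    z ∈ F.region C ↔ F.cellAt C.level z = C := by
  have hw := width_pos h C.level
  rw [Cell.ext_iff]
  simp only [cellAt, true_and, Int.floor_eq_iff, le_div_iff₀ hw, div_lt_iff₀ hw, region,
    Set.mem_ofPred_eq]
  tauto

theorem cellAt_mem_region {F : FMM N} (h : 0 < F.side) (L : ℕ) (z : ℂ) :
    z ∈ F.region (F.cellAt L z) :=
  (mem_region_iff h).mpr rfl

theorem mem_region_child_iff {F : FMM N} (h : 0 < F.side) {C : Cell} {z : ℂ} :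
    z ∈ F.region C ↔ ∃ c, z ∈ F.region (C.child c) := by
  have hw := F.width_eq_two_mul C.level
  have hp := width_pos h (C.level + 1)
  have key : ∀ (t : ℝ) (i : ℤ), (i * F.width C.level ≤ t ∧ t < (i + 1) * F.width C.level) ↔
      ∃ a : Fin 2, ((2 * i + ((a : ℕ) : ℤ) : ℤ) : ℝ) * F.width (C.level + 1) ≤ t ∧
        t < (((2 * i + ((a : ℕ) : ℤ) : ℤ) : ℝ) + 1) * F.width (C.level + 1) := by
    intro t i
    rw [Fin.exists_fin_two, hw]
    push_cast
    simp only [Fin.val_zero, Fin.val_one, Nat.cast_zero, Nat.cast_one]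
    constructor
    · rintro ⟨h1, h2⟩
      rcases lt_or_ge t ((2 * i + 1) * F.width (C.level + 1)) with h3 | h3
      · left; constructor <;> nlinarith
      · right; constructor <;> nlinarith
    · rintro (⟨h1, h2⟩ | ⟨h1, h2⟩) <;> constructor <;> nlinarith
  constructor
  · rintro ⟨h1, h2, h3, h4⟩
    obtain ⟨a, ha⟩ := (key _ _).mp ⟨h1, h2⟩
    obtain ⟨b, hb⟩ := (key _ _).mp ⟨h3, h4⟩
    exact ⟨(a, b), ha.1, ha.2, hb.1, hb.2⟩
  · rintro ⟨⟨a, b⟩, h1, h2, h3, h4⟩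
    have ha := (key _ _).mpr ⟨a, h1, h2⟩
    have hb := (key _ _).mpr ⟨b, h3, h4⟩
    exact ⟨ha.1, ha.2, hb.1, hb.2⟩

theorem _root_.Cell.exists_child_parent {C : Cell} (h : C.level ≠ 0) :
    ∃ c, C.parent.child c = C := by
  refine ⟨(⟨(C.i % 2).toNat, by omega⟩, ⟨(C.j % 2).toNat, by omega⟩), ?_⟩
  ext <;> simp [Cell.child, Cell.parent] <;> omega

theorem _root_.Cell.child_injective (C : Cell) : Function.Injective C.child := by
  rintro ⟨a, b⟩ ⟨a', b'⟩ h
  simp only [Cell.child, Cell.mk.injEq, true_and, add_right_inj, Nat.cast_inj, Fin.val_inj] at h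
  rw [h.1, h.2]

theorem region_subset_parent {F : FMM N} (h : 0 < F.side) {C : Cell} (hC : C.level ≠ 0) {z : ℂ}
    (hz : z ∈ F.region C) : z ∈ F.region C.parent := by
  obtain ⟨c, hc⟩ := Cell.exists_child_parent hC
  rw [mem_region_child_iff h]
  exact ⟨c, by rwa [hc]⟩

theorem parent_cellAt {F : FMM N} (h : 0 < F.side) (L : ℕ) (z : ℂ) :
    (F.cellAt (L + 1) z).parent = F.cellAt L z :=
  ((mem_region_iff h).mp
    (region_subset_parent h (Nat.succ_ne_zero L) (cellAt_mem_region h (L + 1) z))).symm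

theorem closedRegion_subset_parent {F : FMM N} (h : 0 < F.side) {C : Cell} (hC : C.level ≠ 0) :
    F.closedRegion C ⊆ F.closedRegion C.parent := by
  obtain ⟨L, hL⟩ := Nat.exists_eq_succ_of_ne_zero hC
  have hw := F.width_eq_two_mul L
  have hp := width_pos h (L + 1)
  have key : ∀ i : ℤ, 2 * ((i / 2 : ℤ) : ℝ) ≤ i ∧ (i : ℝ) ≤ 2 * ((i / 2 : ℤ) : ℝ) + 1 := by
    intro i
    constructor
    · exact_mod_cast (by omega : 2 * (i / 2) ≤ i)
    · exact_mod_cast (by omega : i ≤ 2 * (i / 2) + 1)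
  obtain ⟨hi, hi'⟩ := key C.i
  obtain ⟨hj, hj'⟩ := key C.j
  rintro z ⟨h1, h2, h3, h4⟩
  simp only [hL, Nat.succ_eq_add_one] at h1 h2 h3 h4
  simp only [closedRegion, Cell.parent, hL, Set.mem_ofPred_eq, Nat.succ_eq_add_one,
    Nat.add_sub_cancel, hw]
  refine ⟨?_, ?_, ?_, ?_⟩ <;> nlinarith

theorem Adjacent.parent_right {F : FMM N} (h : 0 < F.side) {C D : Cell} (hD : D.level ≠ 0)
    (hA : F.Adjacent C D) : F.Adjacent C D.parent :=
  hA.mono (Set.inter_subset_inter_right _ (closedRegion_subset_parent h hD))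

theorem Adjacent.parent_left {F : FMM N} (h : 0 < F.side) {C D : Cell} (hC : C.level ≠ 0)
    (hA : F.Adjacent C D) : F.Adjacent C.parent D :=
  hA.mono (Set.inter_subset_inter_left _ (closedRegion_subset_parent h hC))

/-! ### The cells of the tree that contain a point -/

theorem cellAt_mem_of_le {F : FMM N} (h : 0 < F.side) {z : ℂ} {L M : ℕ} (hM : M ≤ L)
    (hL : F.cellAt L z ∈ F.tree.cells) : F.cellAt M z ∈ F.tree.cells := by
  induction L, hM using Nat.le_induction with
  | base => exact hL
  | succ L _ ih =>
    refine ih ?_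
    rw [← parent_cellAt h]
    exact F.tree.parent_mem _ hL (Nat.succ_ne_zero L)

/-- The cells of level `L` together with the leaves of smaller level. -/
def IsFrontier (F : FMM N) (L : ℕ) (C : Cell) : Prop :=
  C ∈ F.tree.cells ∧ (C.level = L ∨ (C.level < L ∧ F.tree.IsLeaf C))

theorem not_isLeaf_of_cellAt_mem {F : FMM N} (h : 0 < F.side) {z : ℂ} {C : Cell} {L : ℕ}
    (hz : z ∈ F.region C) (hL : F.cellAt L z ∈ F.tree.cells) (hlt : C.level < L) :
    ¬ F.tree.IsLeaf C := by
  intro hleaf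
  have h1 : F.cellAt (C.level + 1) z ∈ F.tree.cells := cellAt_mem_of_le h hlt hL
  obtain ⟨c, hc⟩ := Cell.exists_child_parent (C := F.cellAt (C.level + 1) z) (Nat.succ_ne_zero _)
  rw [parent_cellAt h, (mem_region_iff h).mp hz] at hc
  exact hleaf.2 c (hc ▸ h1)

/-- If the two levels differed, the coarser cell would be a leaf although a deeper cell of the tree
shares a point with it. -/
theorem IsFrontier.eq {F : FMM N} (h : 0 < F.side) {z : ℂ} {L : ℕ} {C C' : Cell}
    (hC : F.IsFrontier L C) (hC' : F.IsFrontier L C') (hz : z ∈ F.region C)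
    (hz' : z ∈ F.region C') : C = C' := by
  have key : ∀ {C C' : Cell}, F.IsFrontier L C → F.IsFrontier L C' → z ∈ F.region C →
      z ∈ F.region C' → ¬ C.level < C'.level := by
    intro C C' hC hC' hz hz' hlt
    have hleaf : F.tree.IsLeaf C := by
      rcases hC.2 with h1 | h1
      · rcases hC'.2 with h2 | h2 <;> omega
      · exact h1.2
    refine not_isLeaf_of_cellAt_mem h hz (L := C'.level) ?_ hlt hleaf
    rw [(mem_region_iff h).mp hz']
    exact hC'.1
  have hl : C.level = C'.level :=
    le_antisymm (not_lt.mp (key hC' hC hz' hz)) (not_lt.mp (key hC hC' hz hz'))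
  rw [← (mem_region_iff h).mp hz, hl, (mem_region_iff h).mp hz']

theorem child_mem_of_not_isLeaf {T : QuadTree} {C : Cell} (hC : C ∈ T.cells)
    (hl : ¬ T.IsLeaf C) (c : Fin 2 × Fin 2) : C.child c ∈ T.cells := by
  simp only [QuadTree.IsLeaf, not_and, not_forall, not_not] at hl
  obtain ⟨c', hc'⟩ := hl hC
  exact T.child_mem C hC c' c hc'

theorem exists_isFrontier {F : FMM N} (h : 0 < F.side) {z : ℂ} (hz : z ∈ F.region Cell.root)
    (L : ℕ) : ∃ C, F.IsFrontier L C ∧ z ∈ F.region C := by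
  induction L with
  | zero => exact ⟨Cell.root, ⟨F.tree.root_mem, Or.inl rfl⟩, hz⟩
  | succ L ih =>
    obtain ⟨C, hC, hzC⟩ := ih
    by_cases hl : F.tree.IsLeaf C
    · exact ⟨C, ⟨hC.1, Or.inr ⟨by rcases hC.2 with h1 | h1 <;> omega, hl⟩⟩, hzC⟩
    · have hlev : C.level = L := by
        rcases hC.2 with h1 | h1
        · exact h1
        · exact absurd h1.2 hl
      obtain ⟨c, hc⟩ := (mem_region_child_iff h).mp hzC
      exact ⟨C.child c, ⟨child_mem_of_not_isLeaf hC.1 hl c, Or.inl (by simp [Cell.child, hlev])⟩, hc⟩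

/-- The frontier cell containing a point is unique, so membership in the far field is decided by
that cell alone. -/
theorem mem_farPoints_iff {F : FMM N} (h : 0 < F.side) {C D : Cell} {j : Fin N}
    (hC : F.IsFrontier D.level C) (hj : F.y j ∈ F.region C) :
    j ∈ F.farPoints D ↔ ¬ F.Adjacent C D := by
  classical
  have hfar : j ∈ F.farPoints D ↔ ∀ C ∈ F.adjacentCells D, F.y j ∉ F.region C := by
    simp [farPoints]
  rw [hfar]
  simp only [adjacentCells, Finset.mem_filter]
  constructor
  · intro h1 hA
    exact h1 C ⟨hC.1, hA, hC.2⟩ hj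
  · rintro h1 C' ⟨hC', hA, hl⟩ hj'
    rw [hC.eq h ⟨hC', hl⟩ hj hj'] at h1
    exact h1 hA

theorem isFrontier_of_mem_wellSeparated {F : FMM N} {C D : Cell} (hC : C ∈ F.wellSeparated D) :
    F.IsFrontier D.level C := by
  simp only [wellSeparated, Finset.mem_filter] at hC
  exact ⟨hC.1, hC.2.2.2.imp (·.1) fun h1 => ⟨h1.1, h1.2.1⟩⟩

/-- Adjacency passes to parents, so the far field grows from parent to child. The points gained are
those whose frontier cell is not adjacent to `D` while the frontier cell one level up is adjacent to
the parent of `D`; that is exactly what well separated means. -/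
theorem sum_farPoints {F : FMM N} (h : 0 < F.side) (hy : ∀ j, F.y j ∈ F.region Cell.root)
    {D : Cell} (hD : D.level ≠ 0) (g : Fin N → ℂ) :
    ∑ j ∈ F.farPoints D, g j = ∑ j ∈ F.farPoints D.parent, g j
      + ∑ C ∈ F.wellSeparated D, ∑ j ∈ F.pointsIn C, g j := by
  classical
  -- One level up, the frontier cell of a point is replaced by its parent if it has the level of
  -- `D`, and is unchanged if it is a coarser leaf.
  have key : ∀ j, ∃ C C', F.IsFrontier D.level C ∧ F.y j ∈ F.region C ∧
      F.IsFrontier D.parent.level C' ∧ F.y j ∈ F.region C' ∧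
      ((C.level = D.level ∧ C' = C.parent) ∨
        (C.level < D.level ∧ F.tree.IsLeaf C ∧ C' = C)) := by
    intro j
    have hpl : D.parent.level = D.level - 1 := rfl
    obtain ⟨C, hC, hj⟩ := exists_isFrontier h (hy j) D.level
    rcases hC.2 with h1 | h1
    · have h0 : C.level ≠ 0 := by omega
      exact ⟨C, C.parent, hC, hj, ⟨F.tree.parent_mem C hC.1 h0,
        Or.inl (by simp [Cell.parent, h1])⟩, region_subset_parent h h0 hj, Or.inl ⟨h1, rfl⟩⟩
    · refine ⟨C, C, hC, hj, ⟨hC.1, ?_⟩, hj, Or.inr ⟨h1.1, h1.2, rfl⟩⟩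
      rcases (by omega : C.level = D.parent.level ∨ C.level < D.parent.level) with h2 | h2
      · exact Or.inl h2
      · exact Or.inr ⟨h2, h1.2⟩
  have hdisj : (F.wellSeparated D : Set Cell).PairwiseDisjoint F.pointsIn := by
    intro C hC C' hC' hne
    rw [Function.onFun, Finset.disjoint_left]
    intro j hj hj'
    simp only [pointsIn, Finset.mem_filter, Finset.mem_univ, true_and] at hj hj'
    exact hne ((isFrontier_of_mem_wellSeparated hC).eq h (isFrontier_of_mem_wellSeparated hC') hj hj')
  have hws : ∀ j, j ∈ (F.wellSeparated D).biUnion F.pointsIn ↔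
      j ∈ F.farPoints D ∧ j ∉ F.farPoints D.parent := by
    intro j
    obtain ⟨C, C', hC, hj, hC', hj', hcase⟩ := key j
    rw [mem_farPoints_iff h hC hj, mem_farPoints_iff h hC' hj', not_not, Finset.mem_biUnion]
    constructor
    · rintro ⟨E, hE, hjE⟩
      simp only [pointsIn, Finset.mem_filter, Finset.mem_univ, true_and] at hjE
      have := (isFrontier_of_mem_wellSeparated hE).eq h hC hjE hj
      subst this
      simp only [wellSeparated, Finset.mem_filter] at hE
      refine ⟨hE.2.2.1, ?_⟩
      rcases hcase with ⟨h1, rfl⟩ | ⟨h1, h2, rfl⟩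
      · rcases hE.2.2.2 with h3 | h3
        · exact h3.2
        · omega
      · rcases hE.2.2.2 with h3 | h3
        · omega
        · exact h3.2.2
    · rintro ⟨hn, ha⟩
      have hjC : j ∈ F.pointsIn C := by simpa [pointsIn] using hj
      refine ⟨C, ?_, hjC⟩
      simp only [wellSeparated, Finset.mem_filter]
      refine ⟨hC.1, ⟨j, hjC⟩, hn, ?_⟩
      rcases hcase with ⟨h1, rfl⟩ | ⟨h1, h2, rfl⟩
      · exact Or.inl ⟨h1, ha⟩
      · exact Or.inr ⟨h1, h2, ha⟩
  have hsub : ∀ j, j ∈ F.farPoints D.parent → j ∈ F.farPoints D := by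
    intro j
    obtain ⟨C, C', hC, hj, hC', hj', hcase⟩ := key j
    rw [mem_farPoints_iff h hC hj, mem_farPoints_iff h hC' hj', not_imp_not]
    intro hA
    have hA' := hA.parent_right h hD
    rcases hcase with ⟨h1, rfl⟩ | ⟨h1, h2, rfl⟩
    · exact hA'.parent_left h (by omega)
    · exact hA'
  rw [← Finset.sum_biUnion hdisj, ← Finset.sum_union]
  · congr 1
    ext j
    rw [Finset.mem_union, hws]
    have := hsub j
    tauto
  · rw [Finset.disjoint_left]
    intro j hj hj'
    exact ((hws j).mp hj').2 hj

/-- The midpoint of the root lies in the closure of every cell of level at most 1, so all these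
cells are adjacent. -/
theorem farPoints_eq_empty {F : FMM N} (h : 0 < F.side) (hy : ∀ j, F.y j ∈ F.region Cell.root)
    {D : Cell} (hD : D ∈ F.tree.cells) (hl : D.level = 1) : F.farPoints D = ∅ := by
  have key : ∀ C ∈ F.tree.cells, C.level ≤ 1 →
      F.corner + ⟨F.width 1, F.width 1⟩ ∈ F.closedRegion C := by
    intro C hC hle
    have hw := F.width_eq_two_mul 0
    have hp := width_pos h 1
    rcases Nat.le_one_iff_eq_zero_or_eq_one.mp hle with h0 | h1
    · have := F.tree.eq_root C hC h0
      subst this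
      rw [zero_add] at hw
      simp only [closedRegion, Cell.root, Set.mem_ofPred_eq, add_sub_cancel_left, hw]
      push_cast
      refine ⟨?_, ?_, ?_, ?_⟩ <;> linarith
    · have hp' := F.tree.eq_root _ (F.tree.parent_mem C hC (by omega)) (by simp [Cell.parent, h1])
      simp only [Cell.parent, Cell.root, Cell.mk.injEq] at hp'
      have hi0 : (0 : ℝ) ≤ C.i := by exact_mod_cast (by omega : 0 ≤ C.i)
      have hi1 : (C.i : ℝ) ≤ 1 := by exact_mod_cast (by omega : C.i ≤ 1)
      have hj0 : (0 : ℝ) ≤ C.j := by exact_mod_cast (by omega : 0 ≤ C.j)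
      have hj1 : (C.j : ℝ) ≤ 1 := by exact_mod_cast (by omega : C.j ≤ 1)
      simp only [closedRegion, Set.mem_ofPred_eq, h1, add_sub_cancel_left]
      refine ⟨?_, ?_, ?_, ?_⟩ <;> nlinarith
  rw [Finset.eq_empty_iff_forall_notMem]
  intro j
  obtain ⟨C, hC, hj⟩ := exists_isFrontier h (hy j) D.level
  rw [mem_farPoints_iff h hC hj, not_not]
  refine ⟨_, key C hC.1 ?_, key D hD hl.le⟩
  rcases hC.2 with h1 | h1 <;> omega

theorem sum_pointsIn_eq_sum_children {F : FMM N} (h : 0 < F.side) (C : Cell) (g : Fin N → ℂ) :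
    ∑ j ∈ F.pointsIn C, g j
      = ∑ c ∈ F.nonemptyChildren C, ∑ j ∈ F.pointsIn (C.child c), g j := by
  classical
  rw [← Finset.sum_biUnion]
  · congr 1
    ext j
    simp only [Finset.mem_biUnion, nonemptyChildren, Finset.mem_filter, Finset.mem_univ, true_and]
    have : j ∈ F.pointsIn C ↔ ∃ c, j ∈ F.pointsIn (C.child c) := by
      simpa [pointsIn] using mem_region_child_iff h (C := C) (z := F.y j)
    rw [this]
    exact ⟨fun ⟨c, hc⟩ => ⟨c, ⟨j, hc⟩, hc⟩, fun ⟨c, _, hc⟩ => ⟨c, hc⟩⟩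
  · intro c _ c' _ hne
    rw [Function.onFun, Finset.disjoint_left]
    intro j hj hj'
    simp only [pointsIn, Finset.mem_filter, Finset.mem_univ, true_and] at hj hj'
    rw [mem_region_iff h] at hj hj'
    exact hne (C.child_injective (hj.symm.trans hj'))

/-! ### Distances between well separated cells -/

/-- All edges lie on the grid of the finer cell. By integrality, a coordinate gap smaller than one
fine width is no gap at all; if this happens in both coordinates, the closed squares meet. -/
theorem separation_of_not_adjacent {F : FMM N} (h : 0 < F.side) {C D : Cell} {d : ℕ}
    (hd : C.level + d = D.level) (hA : ¬ F.Adjacent C D) :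
    ((D.i + 2) * F.width D.level ≤ C.i * F.width C.level ∨
      (C.i + 1) * F.width C.level + F.width D.level ≤ D.i * F.width D.level) ∨
    ((D.j + 2) * F.width D.level ≤ C.j * F.width C.level ∨
      (C.j + 1) * F.width C.level + F.width D.level ≤ D.j * F.width D.level) := by
  have hw : F.width C.level = 2 ^ d * F.width D.level := by rw [← hd]; exact F.width_eq_pow_mul _ _
  have hp := width_pos h D.level
  have hpC := width_pos h C.level
  have key : ∀ a b : ℤ, ¬ ((b + 2) * F.width D.level ≤ a * F.width C.level ∨
      (a + 1) * F.width C.level + F.width D.level ≤ b * F.width D.level) →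
      a * F.width C.level ≤ (b + 1) * F.width D.level ∧
      b * F.width D.level ≤ (a + 1) * F.width C.level := by
    intro a b hab
    rw [not_or, not_le, not_le, hw] at hab
    rw [hw]
    have h1 : (a : ℝ) * 2 ^ d < b + 2 := by
      refine lt_of_mul_lt_mul_right ?_ hp.le
      linarith [hab.1]
    have h2 : (b : ℝ) < (a + 1) * 2 ^ d + 1 := by
      refine lt_of_mul_lt_mul_right ?_ hp.le
      linarith [hab.2]
    have h1' : (a : ℝ) * 2 ^ d ≤ b + 1 := by
      have : a * 2 ^ d < b + 2 := by exact_mod_cast h1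
      exact_mod_cast (by omega : a * 2 ^ d ≤ b + 1)
    have h2' : (b : ℝ) ≤ (a + 1) * 2 ^ d := by
      have : b < (a + 1) * 2 ^ d + 1 := by exact_mod_cast h2
      exact_mod_cast (by omega : b ≤ (a + 1) * 2 ^ d)
    constructor <;> nlinarith
  by_contra hcon
  rw [not_or] at hcon
  obtain ⟨hi1, hi2⟩ := key _ _ hcon.1
  obtain ⟨hj1, hj2⟩ := key _ _ hcon.2
  -- The common point takes the larger of the two left edges and the larger of the two lower edges.
  refine hA ⟨F.corner + ⟨max (C.i * F.width C.level) (D.i * F.width D.level),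
    max (C.j * F.width C.level) (D.j * F.width D.level)⟩, ?_, ?_⟩ <;>
  · simp only [closedRegion, Set.mem_ofPred_eq, add_sub_cancel_left]
    refine ⟨by simp, max_le ?_ ?_, by simp, max_le ?_ ?_⟩ <;> linarith

theorem norm_sub_center_sq_le {F : FMM N} {C : Cell} {z : ℂ} (hz : z ∈ F.region C) :
    ‖z - F.center C‖ ^ 2 ≤ F.width C.level ^ 2 / 2 := by
  obtain ⟨h1, h2, h3, h4⟩ := hz
  rw [Complex.sq_norm, Complex.normSq_apply]
  simp only [center, Complex.sub_re, Complex.sub_im, Complex.add_re, Complex.add_im] at *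
  nlinarith

theorem add_sq_le_norm_sq {z : ℂ} {a : ℝ} (ha : 0 ≤ a) (h : a ≤ |z.re| ∨ a ≤ |z.im|) :
    a ^ 2 ≤ ‖z‖ ^ 2 := by
  refine pow_le_pow_left₀ ha ?_ 2
  rcases h with h | h
  · exact h.trans (Complex.abs_re_le_norm z)
  · exact h.trans (Complex.abs_im_le_norm z)

/-- Here `e` is the depth of `z` inside `D`: it is `0` for a general point and half the width for
the centre. -/
theorem le_norm_sub_center {F : FMM N} (h : 0 < F.side) {C D : Cell} {d : ℕ}
    (hd : C.level + d = D.level) (hA : ¬ F.Adjacent C D) {z : ℂ} {e : ℝ} (he : 0 ≤ e)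
    (hz : (D.i * F.width D.level + e ≤ (z - F.corner).re ∧
       (z - F.corner).re ≤ (D.i + 1) * F.width D.level - e ∧
       D.j * F.width D.level + e ≤ (z - F.corner).im ∧
       (z - F.corner).im ≤ (D.j + 1) * F.width D.level - e)) :
    (F.width C.level / 2 + F.width D.level + e) ^ 2 ≤ ‖z - F.center C‖ ^ 2 := by
  obtain ⟨h1, h2, h3, h4⟩ := hz
  have hp := width_pos h D.level
  have hpC := width_pos h C.level
  refine add_sq_le_norm_sq (by positivity) ?_
  simp only [center, Complex.sub_re, Complex.sub_im, Complex.add_re, Complex.add_im] at *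
  refine (separation_of_not_adjacent h hd hA).imp ?_ ?_ <;>
  · rintro (h5 | h5)
    · rw [le_abs]; right; linarith
    · rw [le_abs]; left; linarith

theorem norm_sub_center_lt_norm_center_sub {F : FMM N} (h : 0 < F.side) {C D : Cell}
    (hle : C.level ≤ D.level) (hA : ¬ F.Adjacent C D) {x : ℂ} (hx : x ∈ F.region D) :
    ‖x - F.center D‖ < ‖F.center D - F.center C‖ := by
  obtain ⟨d, hd⟩ := Nat.exists_eq_add_of_le hle
  have hp := width_pos h D.level
  have hpC := width_pos h C.level
  have h1 := norm_sub_center_sq_le hx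
  have h2 := le_norm_sub_center h hd.symm hA (z := F.center D) (e := F.width D.level / 2)
    (by positivity) (by
      simp only [center, add_sub_cancel_left]
      refine ⟨?_, ?_, ?_, ?_⟩ <;> linarith)
  refine lt_of_pow_lt_pow_left₀ 2 (norm_nonneg _) ?_
  nlinarith

/-- In units of the width of `D`, the claim follows from `4^d / 2 < (2^d / 2 + 1)²`. This holds for
`d = 0, 1, 2` (`8 < 9` in the last case) and fails for `d = 3`, hence the restriction on the levels.
-/
theorem norm_sub_center_lt_of_level_le {F : FMM N} (h : 0 < F.side) {C D : Cell}
    (hle : C.level ≤ D.level) (hle' : D.level ≤ C.level + 2) (hA : ¬ F.Adjacent C D) {x y : ℂ}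
    (hx : x ∈ F.region D) (hy : y ∈ F.region C) :
    ‖y - F.center C‖ < ‖x - F.center C‖ := by
  obtain ⟨d, hd⟩ := Nat.exists_eq_add_of_le hle
  have hp := width_pos h D.level
  have hw : F.width C.level = 2 ^ d * F.width D.level := by rw [hd]; exact F.width_eq_pow_mul _ _
  have h1 := norm_sub_center_sq_le hy
  have h2 := le_norm_sub_center h hd.symm hA (z := x) le_rfl (by
    obtain ⟨h1, h2, h3, h4⟩ := hx
    exact ⟨by linarith, by linarith, by linarith, by linarith⟩)
  refine lt_of_pow_lt_pow_left₀ 2 (norm_nonneg _) (h1.trans_lt (lt_of_lt_of_le ?_ h2))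
  rw [hw]
  have : d ≤ 2 := by omega
  interval_cases d <;> nlinarith

end FMM

/-! ### Translation of truncated expansions -/

theorem angExp_zero (z : ℂ) : angExp 0 z = 1 := by simp [angExp]

theorem angExp_real_mul {k : ℝ} (hk : 0 < k) (m : ℤ) (z : ℂ) :
    angExp m ((k : ℂ) * z) = angExp m z := by
  rw [angExp, angExp, Complex.arg_real_mul z hk]

theorem norm_real_mul {k : ℝ} (hk : 0 < k) (z : ℂ) : ‖(k : ℂ) * z‖ = k * ‖z‖ := by
  rw [norm_mul, Complex.norm_real, Real.norm_of_nonneg hk.le]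

theorem ladder_neg_radialJC (n : ℤ) (z : ℂ) :
    ladder radialJC n (-z) = conj (ladder radialJC (-n) z) := by
  rcases n with n | n
  · rcases n with _ | n
    · simp [ladder, radialJC]
    · change ladder radialJC (Int.ofNat (n + 1)) (-z) = conj (ladder radialJC (Int.negSucc n) z)
      simp only [ladder, radialJC, Complex.normSq_neg, map_mul, map_pow, map_neg, map_one, map_div₀,
        Complex.conj_conj, Complex.conj_ofReal, map_ofNat]
      rw [neg_div, neg_pow]
  · change _ = conj (ladder radialJC (Int.ofNat (n + 1)) z)
    simp only [ladder, radialJC, Complex.normSq_neg, map_mul, map_pow, map_neg, map_div₀,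
      Complex.conj_ofReal, map_ofNat]
    rw [neg_div, neg_pow (conj z / 2), ← mul_assoc, ← mul_pow]
    norm_num

/-- The sign `(-1)^n` from reversing the order cancels the one from turning the angle by `π`. This
converts the argument `-b` of a Graf series into a translation by `+b`. -/
theorem besselJ_neg_mul_angExp_neg (σ : ℤ) (hσ : σ = 1 ∨ σ = -1) (n : ℤ) (z : ℂ) :
    besselJ (-n) ‖z‖ * angExp (σ * n) (-z) = besselJ n ‖z‖ * angExp (σ * n) z := by
  have h : besselJ (-n) ‖z‖ * angExp (-n) (-z) = besselJ n ‖z‖ * angExp (-n) z := by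
    have h1 := besselJ_mul_angExp (-n) (-z)
    rw [norm_neg, ladder_neg_radialJC, neg_neg, ← besselJ_mul_angExp, map_mul, conj_besselJ,
      conj_angExp] at h1
    exact h1
  rcases hσ with rfl | rfl
  · have h2 := congrArg conj h
    simpa only [map_mul, conj_besselJ, conj_angExp, neg_neg, one_mul] using h2
  · simpa using h

theorem grafTerm_neg {k : ℝ} (hk : 0 < k) (B : ℤ → ℝ → ℂ) {σ : ℤ} (hσ : σ = 1 ∨ σ = -1)
    (m l : ℤ) (a b : ℂ) :
    grafTerm B σ m ((k : ℂ) * a) (-((k : ℂ) * b)) (-l)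
      = B (m - l) (k * ‖a‖) * angExp (σ * (m - l)) a * (besselJ l (k * ‖b‖) * angExp (σ * l) b) := by
  rw [grafTerm, ← sub_eq_add_neg, norm_neg, mul_neg, neg_neg, besselJ_neg_mul_angExp_neg σ hσ,
    angExp_real_mul hk, angExp_real_mul hk, norm_real_mul hk, norm_real_mul hk]

/-- Graf's series at `-b`, with the summation index negated; the truncation range is symmetric, so
the remainder is unaffected. -/
theorem translation {k : ℝ} (hk : 0 < k) {B : ℤ → ℝ → ℂ} {σ : ℤ} (hσ : σ = 1 ∨ σ = -1)
    {m : ℤ} {a b s : ℂ} (h : HasSum (grafTerm B σ m ((k : ℂ) * a) (-((k : ℂ) * b))) s) (p : ℕ) :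
    s = ∑ l ∈ Finset.Icc (-(p : ℤ)) p,
        B (m - l) (k * ‖a‖) * angExp (σ * (m - l)) a * (besselJ l (k * ‖b‖) * angExp (σ * l) b)
      + grafRemainder B σ m p ((k : ℂ) * a) (-((k : ℂ) * b)) := by
  rw [sum_add_grafRemainder h p]
  congr 1
  refine Finset.sum_nbij' (fun n => -n) (fun n => -n) ?_ ?_ ?_ ?_ ?_
  · intro n hn
    simp only [Finset.mem_Icc] at hn ⊢
    omega
  · intro n hn
    simp only [Finset.mem_Icc] at hn ⊢
    omega
  · simp
  · simp
  · intro n _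
    rw [← grafTerm_neg hk B hσ, neg_neg]

theorem real_mul_sub_neg (k : ℝ) (a b : ℂ) : (k : ℂ) * a - -((k : ℂ) * b) = k * (a + b) := by ring

theorem besselJ_translation {k : ℝ} (hk : 0 < k) (m : ℤ) (a b : ℂ) (p : ℕ) :
    besselJ m (k * ‖a + b‖) * angExp m (a + b) = ∑ l ∈ Finset.Icc (-(p : ℤ)) p,
        besselJ (m - l) (k * ‖a‖) * angExp (m - l) a * (besselJ l (k * ‖b‖) * angExp l b)
      + grafRemainder besselJ 1 m p ((k : ℂ) * a) (-((k : ℂ) * b)) := by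
  have h := translation hk (Or.inl rfl)
    (hasSum_grafTerm_besselJ m ((k : ℂ) * a) (-((k : ℂ) * b))) p
  simpa only [real_mul_sub_neg, norm_real_mul hk, angExp_real_mul hk, one_mul] using h

theorem besselJ_translation_neg {k : ℝ} (hk : 0 < k) (m : ℤ) (a b : ℂ) (p : ℕ) :
    besselJ m (k * ‖a + b‖) * angExp (-m) (a + b) = ∑ l ∈ Finset.Icc (-(p : ℤ)) p,
        besselJ (m - l) (k * ‖a‖) * angExp (-(m - l)) a * (besselJ l (k * ‖b‖) * angExp (-l) b)
      + grafRemainder besselJ (-1) m p ((k : ℂ) * a) (-((k : ℂ) * b)) := by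
  have h := translation hk (Or.inr rfl)
    (hasSum_grafTerm_besselJ_neg m ((k : ℂ) * a) (-((k : ℂ) * b))) p
  simpa only [real_mul_sub_neg, norm_real_mul hk, angExp_real_mul hk, neg_one_mul] using h

theorem hankelH_translation {k : ℝ} (hk : 0 < k) (m : ℤ) {a b : ℂ} (hab : ‖b‖ < ‖a‖) (p : ℕ) :
    hankelH m (k * ‖a + b‖) * angExp m (a + b) = ∑ l ∈ Finset.Icc (-(p : ℤ)) p,
        hankelH (m - l) (k * ‖a‖) * angExp (m - l) a * (besselJ l (k * ‖b‖) * angExp l b)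
      + grafRemainder hankelH 1 m p ((k : ℂ) * a) (-((k : ℂ) * b)) := by
  have hab' : ‖-((k : ℂ) * b)‖ < ‖(k : ℂ) * a‖ := by
    rw [norm_neg, norm_real_mul hk, norm_real_mul hk]
    gcongr
  have h := translation hk (Or.inl rfl) (hasSum_grafTerm_hankelH m hab') p
  simpa only [real_mul_sub_neg, norm_real_mul hk, angExp_real_mul hk, one_mul] using h

/-- The multipole expansion of the fundamental solution. -/
theorem hankelH_multipole {k : ℝ} (hk : 0 < k) {a b : ℂ} (hab : ‖b‖ < ‖a‖) (p : ℕ) :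
    hankelH 0 (k * ‖a - b‖) = ∑ n ∈ Finset.Icc (-(p : ℤ)) p,
        hankelH n (k * ‖a‖) * angExp n a * (besselJ n (k * ‖b‖) * angExp (-n) b)
      + grafRemainder hankelH 1 0 p ((k : ℂ) * a) ((k : ℂ) * b) := by
  have hab' : ‖(k : ℂ) * b‖ < ‖(k : ℂ) * a‖ := by
    rw [norm_real_mul hk, norm_real_mul hk]
    gcongr
  have h := sum_add_grafRemainder (hasSum_grafTerm_hankelH 0 hab') p
  rw [← mul_sub] at h
  simpa only [grafTerm, norm_real_mul hk, angExp_real_mul hk, one_mul, zero_add, angExp_zero,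
    mul_one] using h

/-! ### Errors of the moments and assembly over the levels -/

namespace FMM

variable {N : ℕ}

theorem moment_eq_children {F : FMM N} (hk : 0 < F.k) (hs : 0 < F.side) (p : ℕ) (C : Cell)
    (n : ℤ) : F.moment C n = ∑ c ∈ F.nonemptyChildren C, ∑ l ∈ Finset.Icc (-(p : ℤ)) p,
      F.moment (C.child c) l *
        (besselJ (n - l) (F.k * ‖F.center (C.child c) - F.center C‖) *
          angExp (-(n - l)) (F.center (C.child c) - F.center C)) + F.errM2M p C n := by
  rw [moment, sum_pointsIn_eq_sum_children hs, errM2M, ← Finset.sum_add_distrib]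
  refine Finset.sum_congr rfl fun c _ => ?_
  simp only [moment, Finset.sum_mul]
  rw [Finset.sum_comm, ← Finset.sum_add_distrib]
  refine Finset.sum_congr rfl fun j _ => ?_
  have h := besselJ_translation_neg hk n (F.center (C.child c) - F.center C)
    (F.y j - F.center (C.child c)) p
  rw [sub_add_sub_cancel'] at h
  rw [h, add_mul, Finset.sum_mul]
  congr 1
  exact Finset.sum_congr rfl fun l _ => by ring

/-- Induction on the remaining depth of the tree: the translation from the children is linear, so it
carries the splitting of their moments upwards, and its own truncation adds `errM2M`. -/
theorem moment_eq_approxMoment_add_momentError {F : FMM N} (hk : 0 < F.k) (hs : 0 < F.side)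
    (p : ℕ) (C : Cell) (n : ℤ) (hC : C ∈ F.tree.cells) :
    F.moment C n = F.approxMoment p C n + F.momentError p C n := by
  induction hm : F.tree.depth + 1 - C.level using Nat.strong_induction_on generalizing C n with
  | _ d ih =>
    by_cases hl : F.tree.IsLeaf C
    · rw [approxMoment, momentError, dif_neg (by tauto), dif_neg (by tauto), add_zero]
    · have hdiv : C ∈ F.tree.cells ∧ ¬ F.tree.IsLeaf C := ⟨hC, hl⟩
      rw [approxMoment, momentError, dif_pos hdiv, dif_pos hdiv, moment_eq_children hk hs p,
        ← add_assoc, ← Finset.sum_add_distrib]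
      congr 1
      refine Finset.sum_congr rfl fun c _ => ?_
      rw [← Finset.sum_add_distrib]
      refine Finset.sum_congr rfl fun l _ => ?_
      rw [ih _ (hm ▸ depth_lt hdiv c) (C.child c) l (child_mem_of_not_isLeaf hC hl c) rfl]
      ring

/-- The field of a cell seen from a well separated cell. -/
theorem sum_pointsIn_eq {F : FMM N} (hk : 0 < F.k) (hs : 0 < F.side) (p : ℕ) {C D : Cell}
    (hC : C ∈ F.tree.cells) {x : ℂ}
    (hx : ‖x - F.center D‖ < ‖F.center D - F.center C‖)
    (hy : ∀ j ∈ F.pointsIn C, ‖F.y j - F.center C‖ < ‖x - F.center C‖) :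
    ∑ j ∈ F.pointsIn C, hankelH 0 (F.k * ‖x - F.y j‖) * F.weight j
      = ∑ m ∈ Finset.Icc (-(p : ℤ)) p, (∑ n ∈ Finset.Icc (-(p : ℤ)) p, F.approxMoment p C n *
          (hankelH (n - m) (F.k * ‖F.center D - F.center C‖) *
            angExp (n - m) (F.center D - F.center C))) *
          (besselJ m (F.k * ‖x - F.center D‖) * angExp m (x - F.center D))
        + (∑ j ∈ F.pointsIn C, grafRemainder hankelH 1 0 p ((F.k : ℂ) * (x - F.center C))
              ((F.k : ℂ) * (F.y j - F.center C)) * F.weight j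
          + ∑ n ∈ Finset.Icc (-(p : ℤ)) p,
              hankelH n (F.k * ‖x - F.center C‖) * angExp n (x - F.center C) *
                F.momentError p C n
          + ∑ n ∈ Finset.Icc (-(p : ℤ)) p,
              grafRemainder hankelH 1 n p ((F.k : ℂ) * (F.center D - F.center C))
                (-((F.k : ℂ) * (x - F.center D))) * F.approxMoment p C n) := by
  have h1 : ∑ j ∈ F.pointsIn C, hankelH 0 (F.k * ‖x - F.y j‖) * F.weight j
      = ∑ n ∈ Finset.Icc (-(p : ℤ)) p,
          hankelH n (F.k * ‖x - F.center C‖) * angExp n (x - F.center C) * F.moment C n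
        + ∑ j ∈ F.pointsIn C, grafRemainder hankelH 1 0 p ((F.k : ℂ) * (x - F.center C))
              ((F.k : ℂ) * (F.y j - F.center C)) * F.weight j := by
    simp only [moment, Finset.mul_sum]
    rw [Finset.sum_comm, ← Finset.sum_add_distrib]
    refine Finset.sum_congr rfl fun j hj => ?_
    have h := hankelH_multipole hk (hy j hj) p
    rw [sub_sub_sub_cancel_right] at h
    rw [h, add_mul, Finset.sum_mul]
    congr 1
    exact Finset.sum_congr rfl fun n _ => by ring
  have h2 : ∑ n ∈ Finset.Icc (-(p : ℤ)) p,
        hankelH n (F.k * ‖x - F.center C‖) * angExp n (x - F.center C) * F.approxMoment p C n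
      = ∑ m ∈ Finset.Icc (-(p : ℤ)) p, (∑ n ∈ Finset.Icc (-(p : ℤ)) p, F.approxMoment p C n *
          (hankelH (n - m) (F.k * ‖F.center D - F.center C‖) *
            angExp (n - m) (F.center D - F.center C))) *
          (besselJ m (F.k * ‖x - F.center D‖) * angExp m (x - F.center D))
        + ∑ n ∈ Finset.Icc (-(p : ℤ)) p,
              grafRemainder hankelH 1 n p ((F.k : ℂ) * (F.center D - F.center C))
                (-((F.k : ℂ) * (x - F.center D))) * F.approxMoment p C n := by
    simp only [Finset.sum_mul]
    rw [Finset.sum_comm, ← Finset.sum_add_distrib]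
    refine Finset.sum_congr rfl fun n _ => ?_
    have h := hankelH_translation hk n hx p
    rw [sub_add_sub_cancel'] at h
    rw [h, add_mul, Finset.sum_mul]
    congr 1
    exact Finset.sum_congr rfl fun n _ => by ring
  -- The exact moments are split only now, so the translation to `D` acts on the approximate moments
  -- alone, while the moment errors keep the exact factors `H_n` at `x`.
  rw [h1]
  simp only [moment_eq_approxMoment_add_momentError hk hs p C _ hC, mul_add,
    Finset.sum_add_distrib]
  rw [h2]
  ring

/-- The field of the well separated cells is the multipole-to-local expansion up to errors. -/
theorem sum_wellSeparated_eq {F : FMM N} (hk : 0 < F.k) (hs : 0 < F.side) (p : ℕ) {D : Cell}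
    {x : ℂ} (hx : ∀ C ∈ F.wellSeparated D, ‖x - F.center D‖ < ‖F.center D - F.center C‖)
    (hy : ∀ C ∈ F.wellSeparated D, ∀ j ∈ F.pointsIn C,
      ‖F.y j - F.center C‖ < ‖x - F.center C‖) :
    ∑ C ∈ F.wellSeparated D, ∑ j ∈ F.pointsIn C, hankelH 0 (F.k * ‖x - F.y j‖) * F.weight j
      = ∑ m ∈ Finset.Icc (-(p : ℤ)) p, F.localM2L p D m *
          (besselJ m (F.k * ‖x - F.center D‖) * angExp m (x - F.center D))
        + (∑ C ∈ F.wellSeparated D, ∑ j ∈ F.pointsIn C,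
              grafRemainder hankelH 1 0 p ((F.k : ℂ) * (x - F.center C))
                ((F.k : ℂ) * (F.y j - F.center C)) * F.weight j
          + ∑ C ∈ F.wellSeparated D, ∑ n ∈ Finset.Icc (-(p : ℤ)) p,
              hankelH n (F.k * ‖x - F.center C‖) * angExp n (x - F.center C) *
                F.momentError p C n
          + ∑ C ∈ F.wellSeparated D, ∑ n ∈ Finset.Icc (-(p : ℤ)) p,
              grafRemainder hankelH 1 n p ((F.k : ℂ) * (F.center D - F.center C))
                (-((F.k : ℂ) * (x - F.center D))) * F.approxMoment p C n) := by
  have h : ∑ m ∈ Finset.Icc (-(p : ℤ)) p, F.localM2L p D m *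
          (besselJ m (F.k * ‖x - F.center D‖) * angExp m (x - F.center D))
      = ∑ C ∈ F.wellSeparated D, ∑ m ∈ Finset.Icc (-(p : ℤ)) p,
        (∑ n ∈ Finset.Icc (-(p : ℤ)) p, F.approxMoment p C n *
          (hankelH (n - m) (F.k * ‖F.center D - F.center C‖) *
            angExp (n - m) (F.center D - F.center C))) *
          (besselJ m (F.k * ‖x - F.center D‖) * angExp m (x - F.center D)) := by
    simp only [localM2L]
    rw [Finset.sum_comm]
    exact Finset.sum_congr rfl fun m _ => Finset.sum_mul _ _ _
  rw [h]
  simp only [← Finset.sum_add_distrib]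
  refine Finset.sum_congr rfl fun C hC => ?_
  rw [sum_pointsIn_eq hk hs p (isFrontier_of_mem_wellSeparated hC).1 (hx C hC) (hy C hC)]

/-- Truncated translation of a local expansion from the center of `E` to the center of `D`. -/
theorem sum_local_translation {F : FMM N} (hk : 0 < F.k) (p : ℕ) (D E : Cell) (x : ℂ)
    (c : ℤ → ℂ) :
    ∑ l ∈ Finset.Icc (-(p : ℤ)) p,
        c l * (besselJ l (F.k * ‖x - F.center E‖) * angExp l (x - F.center E))
      = ∑ m ∈ Finset.Icc (-(p : ℤ)) p, (∑ l ∈ Finset.Icc (-(p : ℤ)) p, c l *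
          (besselJ (l - m) (F.k * ‖F.center D - F.center E‖) *
            angExp (l - m) (F.center D - F.center E))) *
          (besselJ m (F.k * ‖x - F.center D‖) * angExp m (x - F.center D))
        + ∑ n ∈ Finset.Icc (-(p : ℤ)) p,
            grafRemainder besselJ 1 n p ((F.k : ℂ) * (F.center D - F.center E))
              (-((F.k : ℂ) * (x - F.center D))) * c n := by
  simp only [Finset.sum_mul]
  rw [Finset.sum_comm, ← Finset.sum_add_distrib]
  refine Finset.sum_congr rfl fun n _ => ?_
  have h := besselJ_translation hk n (F.center D - F.center E) (x - F.center D) p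
  rw [sub_add_sub_cancel'] at h
  rw [h, mul_add, Finset.mul_sum, mul_comm (c n) (grafRemainder _ _ _ _ _ _)]
  congr 1
  exact Finset.sum_congr rfl fun n _ => by ring

theorem approxLocal_of_level_eq_two {F : FMM N} {p : ℕ} {D : Cell} (h : D.level = 2) (m : ℤ) :
    F.approxLocal p D m = F.localM2L p D m := by
  rw [approxLocal, h]
  rfl

theorem approxLocal_of_three_le {F : FMM N} {p : ℕ} {D : Cell} (h : 3 ≤ D.level) (m : ℤ) :
    F.approxLocal p D m = F.localM2L p D m +
      ∑ l ∈ Finset.Icc (-(p : ℤ)) p, F.approxLocal p D.parent l *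
        (besselJ (l - m) (F.k * ‖F.center D - F.center D.parent‖) *
          angExp (l - m) (F.center D - F.center D.parent)) := by
  obtain ⟨t, ht⟩ := Nat.exists_eq_add_of_le h
  have h1 : D.level - 2 = t + 1 := by omega
  have h2 : D.parent.level - 2 = t := by
    change D.level - 1 - 2 = t
    omega
  simp only [approxLocal, h1, h2]
  rfl

/-- Induction on the level with `x` fixed: the inherited far field is the expansion about the
parent's centre, and re-centring it costs one `J` remainder per level. -/
theorem sum_farPoints_eq {F : FMM N} (p : ℕ) (hk : 0 < F.k) (hside : 0 < F.side)
    (hy : ∀ j, F.y j ∈ F.region Cell.root) {D : ℕ → Cell} {M : ℕ} (hM : 2 ≤ M)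
    (hD : ∀ L ∈ Finset.Icc 2 M, D L ∈ F.tree.cells ∧ (D L).level = L)
    (hparent : ∀ L ∈ Finset.Icc 3 M, (D L).parent = D (L - 1)) {x : ℂ}
    (hx : ∀ L ∈ Finset.Icc 2 M, ∀ C ∈ F.wellSeparated (D L),
      ‖x - F.center (D L)‖ < ‖F.center (D L) - F.center C‖)
    (hxy : ∀ L ∈ Finset.Icc 2 M, ∀ C ∈ F.wellSeparated (D L), ∀ j ∈ F.pointsIn C,
      ‖F.y j - F.center C‖ < ‖x - F.center C‖) :
    ∑ j ∈ F.farPoints (D M), hankelH 0 (F.k * ‖x - F.y j‖) * F.weight j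
      = ∑ m ∈ Finset.Icc (-(p : ℤ)) p, F.approxLocal p (D M) m *
          (besselJ m (F.k * ‖x - F.center (D M)‖) * angExp m (x - F.center (D M)))
        + (∑ L ∈ Finset.Icc 2 M, ∑ C ∈ F.wellSeparated (D L), ∑ j ∈ F.pointsIn C,
              grafRemainder hankelH 1 0 p ((F.k : ℂ) * (x - F.center C))
                ((F.k : ℂ) * (F.y j - F.center C)) * F.weight j
          + ∑ L ∈ Finset.Icc 2 M, ∑ C ∈ F.wellSeparated (D L),
              ∑ n ∈ Finset.Icc (-(p : ℤ)) p,
                hankelH n (F.k * ‖x - F.center C‖) * angExp n (x - F.center C) *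
                  F.momentError p C n
          + ∑ L ∈ Finset.Icc 2 M, ∑ C ∈ F.wellSeparated (D L),
              ∑ n ∈ Finset.Icc (-(p : ℤ)) p,
                grafRemainder hankelH 1 n p ((F.k : ℂ) * (F.center (D L) - F.center C))
                  (-((F.k : ℂ) * (x - F.center (D L)))) * F.approxMoment p C n
          + ∑ L ∈ Finset.Icc 3 M, ∑ n ∈ Finset.Icc (-(p : ℤ)) p,
              grafRemainder besselJ 1 n p ((F.k : ℂ) * (F.center (D L) - F.center (D (L - 1))))
                (-((F.k : ℂ) * (x - F.center (D L)))) * F.approxLocal p (D (L - 1)) n) := by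
  induction M, hM using Nat.le_induction with
  | base =>
    have h2 : 2 ∈ Finset.Icc 2 2 := by simp
    obtain ⟨hmem, hlev⟩ := hD 2 h2
    have hne : (D 2).level ≠ 0 := by omega
    -- The parent has level 1 and no far field, so level 2 inherits nothing.
    rw [sum_farPoints hside hy hne,
      farPoints_eq_empty hside hy (F.tree.parent_mem _ hmem hne) (by simp [Cell.parent, hlev]),
      sum_wellSeparated_eq hk hside p (hx 2 h2) (hxy 2 h2)]
    simp [approxLocal_of_level_eq_two hlev]
  | succ M hM ih =>
    have hsub : ∀ {a : ℕ}, ∀ L ∈ Finset.Icc a M, L ∈ Finset.Icc a (M + 1) := fun L hL =>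
      Finset.Icc_subset_Icc_right (Nat.le_succ M) hL
    have hM1 : M + 1 ∈ Finset.Icc 2 (M + 1) := by simp; omega
    obtain ⟨_, hlev⟩ := hD _ hM1
    have hp : (D (M + 1)).parent = D M := hparent (M + 1) (by simp; omega)
    have ih' := ih (fun L hL => hD L (hsub L hL)) (fun L hL => hparent L (hsub L hL))
      (fun L hL => hx L (hsub L hL)) (fun L hL => hxy L (hsub L hL))
    -- The translated parent expansion and the contribution of the well separated cells combine to
    -- the recursion for `approxLocal`.
    rw [sum_farPoints hside hy (by omega), hp, ih',
      sum_wellSeparated_eq hk hside p (hx _ hM1) (hxy _ hM1),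
      sum_local_translation hk p (D (M + 1)) (D M) x]
    rw [Finset.sum_Icc_succ_top (a := 2) (by omega), Finset.sum_Icc_succ_top (a := 2) (by omega),
      Finset.sum_Icc_succ_top (a := 2) (by omega), Finset.sum_Icc_succ_top (a := 3) (by omega)]
    simp only [approxLocal_of_three_le (D := D (M + 1)) (by omega), hp, add_mul,
      Finset.sum_add_distrib, Nat.add_sub_cancel]
    ring

end FMM

end

theorem theorem3 {N : ℕ} (F : FMM N) (p : ℕ) (hk : 0 < F.k) (hside : 0 < F.side)
    (hy : ∀ j, F.y j ∈ F.region Cell.root)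
    (Lmax : ℕ) (hLmax : 2 ≤ Lmax) (D : ℕ → Cell)
    (hD : ∀ L ∈ Finset.Icc 2 Lmax, D L ∈ F.tree.cells ∧ (D L).level = L)
    (hparent : ∀ L ∈ Finset.Icc 3 Lmax, (D L).parent = D (L - 1))
    (hleaf : F.tree.IsLeaf (D Lmax))
    (x : ℂ) (hx : x ∈ F.region (D Lmax))
    (hconv : ∀ L ∈ Finset.Icc 2 Lmax, ∀ C ∈ F.wellSeparated (D L), C.level + 2 < L →
      ∀ j ∈ F.pointsIn C, ‖F.y j - F.center C‖ < ‖x - F.center C‖) :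
    -- the far field is the truncated local expansion at the leaf plus the four parts of the error
    (∑ j ∈ F.farPoints (D Lmax), hankelH 0 (F.k * ‖x - F.y j‖) * F.weight j
      = ∑ m ∈ Finset.Icc (-(p : ℤ)) p, F.approxLocal p (D Lmax) m *
          (besselJ m (F.k * ‖x - F.center (D Lmax)‖) * angExp m (x - F.center (D Lmax)))
        + (∑ L ∈ Finset.Icc 2 Lmax, ∑ C ∈ F.wellSeparated (D L), ∑ j ∈ F.pointsIn C,
              grafRemainder hankelH 1 0 p ((F.k : ℂ) * (x - F.center C))
                ((F.k : ℂ) * (F.y j - F.center C)) * F.weight j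
          + ∑ L ∈ Finset.Icc 2 Lmax, ∑ C ∈ F.wellSeparated (D L),
              ∑ n ∈ Finset.Icc (-(p : ℤ)) p,
                hankelH n (F.k * ‖x - F.center C‖) * angExp n (x - F.center C) *
                  F.momentError p C n
          + ∑ L ∈ Finset.Icc 2 Lmax, ∑ C ∈ F.wellSeparated (D L),
              ∑ n ∈ Finset.Icc (-(p : ℤ)) p,
                grafRemainder hankelH 1 n p ((F.k : ℂ) * (F.center (D L) - F.center C))
                  (-((F.k : ℂ) * (x - F.center (D L)))) * F.approxMoment p C n
          + ∑ L ∈ Finset.Icc 3 Lmax, ∑ n ∈ Finset.Icc (-(p : ℤ)) p,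
              grafRemainder besselJ 1 n p ((F.k : ℂ) * (F.center (D L) - F.center (D (L - 1))))
                (-((F.k : ℂ) * (x - F.center (D L)))) * F.approxLocal p (D (L - 1)) n)) ∧
    -- the `EM_n` are the errors of the multipole moments
    (∀ C ∈ F.tree.cells, ∀ n : ℤ,
      F.moment C n = F.approxMoment p C n + F.momentError p C n) ∧
    -- the series of all the remainders that occur converge absolutely
    (∀ L ∈ Finset.Icc 2 Lmax, ∀ C ∈ F.wellSeparated (D L), ∀ j ∈ F.pointsIn C,
      Summable (grafTerm hankelH 1 0 ((F.k : ℂ) * (x - F.center C))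
        ((F.k : ℂ) * (F.y j - F.center C)))) ∧
    (∀ L ∈ Finset.Icc 2 Lmax, ∀ C ∈ F.wellSeparated (D L), ∀ n : ℤ,
      Summable (grafTerm hankelH 1 n ((F.k : ℂ) * (F.center (D L) - F.center C))
        (-((F.k : ℂ) * (x - F.center (D L)))))) ∧
    (∀ L ∈ Finset.Icc 3 Lmax, ∀ n : ℤ,
      Summable (grafTerm besselJ 1 n ((F.k : ℂ) * (F.center (D L) - F.center (D (L - 1))))
        (-((F.k : ℂ) * (x - F.center (D L)))))) ∧
    (∀ C ∈ F.tree.cells, ∀ c, ∀ j ∈ F.pointsIn (C.child c), ∀ n : ℤ,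
      Summable (grafTerm besselJ (-1) n ((F.k : ℂ) * (F.center (C.child c) - F.center C))
        (-((F.k : ℂ) * (F.y j - F.center (C.child c)))))) := by
  have hxD : ∀ L ∈ Finset.Icc 2 Lmax, x ∈ F.region (D L) := by
    intro L hL
    obtain ⟨h2, hle⟩ := Finset.mem_Icc.mp hL
    induction hle using Nat.decreasingInduction with
    | self => exact hx
    | of_succ L hlt ih =>
      have hmem : L + 1 ∈ Finset.Icc 2 Lmax := Finset.mem_Icc.mpr ⟨by omega, hlt⟩
      have hp := hparent (L + 1) (Finset.mem_Icc.mpr ⟨by omega, hlt⟩)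
      rw [Nat.add_sub_cancel] at hp
      rw [← hp]
      exact FMM.region_subset_parent hside (by rw [(hD _ hmem).2]; omega) (ih hmem (by omega))
  have hsep : ∀ {L C}, C ∈ F.wellSeparated (D L) →
      C.level ≤ (D L).level ∧ ¬ F.Adjacent C (D L) := by
    intro L C hC
    refine ⟨?_, ?_⟩
    · rcases (FMM.isFrontier_of_mem_wellSeparated hC).2 with h | h <;> omega
    · simp only [FMM.wellSeparated, Finset.mem_filter] at hC
      exact hC.2.2.1
  have hxc : ∀ L ∈ Finset.Icc 2 Lmax, ∀ C ∈ F.wellSeparated (D L),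
      ‖x - F.center (D L)‖ < ‖F.center (D L) - F.center C‖ := fun L hL C hC =>
    FMM.norm_sub_center_lt_norm_center_sub hside (hsep hC).1 (hsep hC).2 (hxD L hL)
  have hxy : ∀ L ∈ Finset.Icc 2 Lmax, ∀ C ∈ F.wellSeparated (D L), ∀ j ∈ F.pointsIn C,
      ‖F.y j - F.center C‖ < ‖x - F.center C‖ := by
    intro L hL C hC j hj
    -- Up to two levels of difference the geometry gives the inequality; beyond that it is the
    -- convergence hypothesis.
    by_cases hlt : C.level + 2 < L
    · exact hconv L hL C hC hlt j hj
    · refine FMM.norm_sub_center_lt_of_level_le hside (hsep hC).1 ?_ (hsep hC).2 (hxD L hL) ?_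
      · rw [(hD L hL).2]
        omega
      · simpa [FMM.pointsIn] using hj
  refine ⟨FMM.sum_farPoints_eq p hk hside hy hLmax hD hparent hxc hxy,
    fun C hC n => FMM.moment_eq_approxMoment_add_momentError hk hside p C n hC,
    fun L hL C hC j hj => (hasSum_grafTerm_hankelH 0 ?_).summable,
    fun L hL C hC n => (hasSum_grafTerm_hankelH n ?_).summable,
    fun L _ n => (hasSum_grafTerm_besselJ n _ _).summable,
    fun C _ c j _ n => (hasSum_grafTerm_besselJ_neg n _ _).summable⟩
  · rw [norm_real_mul hk, norm_real_mul hk]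
    have := hxy L hL C hC j hj
    gcongr
  · rw [norm_neg, norm_real_mul hk, norm_real_mul hk]
    have := hxc L hL C hC
    gcongr
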